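/- Let $d\ge 2$, let $\Omega\subset\mathbb R^d$ be a bounded domain (nonempty, open, connected), $T>0$, $\nu\ge 0$. Let $C^\infty_{c,\sigma}(\Omega)$ be the smooth divergence-free fields with compact support in $\Omega$, and $L^2_\sigma$, $H^1_{0,\sigma}$ its closures in $L^2(\Omega)^d$ and $H^1(\Omega)^d$. If $\nu>0$, put $\mathbb X=L^\infty(0,T;L^2_\sigma)\cap L^2(0,T;H^1_{0,\sigma})$, $\mathbb Y=\mathbb X\cap L^2(0,T;H^2)\cap L^1(0,T;W^{1,\infty})\cap H^1(0,T;(L^2_\sigma)^*)$, $\mathbb Z=L^2(0,T;H^{-1})\oplus L^1(0,T;L^2)$; if $\nu=0$, put $\mathbb X=L^\infty(0,T;L^2_\sigma)$, $\mathbb Y=\mathbb X\cap L^1(0,T;W^{1,\infty})\cap H^1(0,T;(L^2_\sigma)^*)$, $\mathbb Z=L^1(0,T;L^2)$. Let $f\in\mathbb Z$ and $v_0\in L^2_\sigma$. Elements of $\mathbb Y$ are taken in their continuous representative $[0,T]\to L^2_\sigma$. Put $\mathcal R(v|\tilde v)=\frac12\|v-\tilde v\|_{L^2}^2$ and $\langle\mathcal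 A_\nu(\tilde v),\cdot\rangle=\langle\partial_t\tilde v+(\tilde v\cdot\nabla)\tilde v-\nu\Delta\tilde v-f,\cdot\rangle$. For $\mathcal K:L^2_\sigma\to[0,\infty]$ put $\mathcal D(\mathcal K)=\{\tilde v\in\mathbb X:\mathcal K(\tilde v)\in L^1(0,T)\}$ and $$\mathcal W_\nu(v|\tilde v)=\nu\|\nabla v-\nabla\tilde v\|_{L^2}^2-\int_\Omega((v-\tilde v)\cdot\nabla)(v-\tilde v)\cdot\tilde v\,dx+\mathcal K(\tilde v)\mathcal R(v|\tilde v)\quad(\nu>0),$$ $$\mathcal W_0(v|\tilde v)=\int_\Omega(v-\tilde v)^T(\nabla\tilde v)_{\rm sym}(v-\tilde v)\,dx+\mathcal K(\tilde v)\mathcal R(v|\tilde v).$$ $\mathcal K$ is called admissible if $\mathcal K(0)=0$; $C^1([0,T];C^\infty_{c,\sigma}(\Omega))\subset\mathcal D(\mathcal K)$; there is a topology on $\mathcal D(\mathcal K)$ for which this subset is dense and $\mathcal K:\mathcal D(\mathcal K)\to L^1(0,T)$ is continuous; and $\mathcal W_\nu(v|\tilde v)\ge0$ a.e. in $(0,T)$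 for all $v\in\mathbb X$ and $\tilde v\in\mathbb Y\cap\mathcal D(\mathcal K)$. A pair $(v,\xi)\in\mathbb X\times L^\infty(0,T)$ with $\xi(t)\ge0$ for all $t\in(0,T)$ is an energy-variational solution if, for every admissible $\mathcal K$, every $\tilde v\in\mathbb Y\cap\mathcal D(\mathcal K)$ and all $0\le s\le t\le T$, $$[\mathcal R(v|\tilde v(t))+\xi](t+)+\int_s^t\Big(\mathcal W_\nu(v|\tilde v)+\langle\mathcal A_\nu(\tilde v),v-\tilde v\rangle-\mathcal K(\tilde v)\big(\mathcal R(v|\tilde v)+\xi\big)\Big)d\tau\le[\mathcal R(v|\tilde v(s))+\xi](s-),$$ where $(t+)$ and $(s-)$ denote essential right and left limits in time, required to exist (at $t=T$ and at $s=0$ the limit is taken from inside $(0,T)$), and if $v(\tau)\rightharpoonup v_0$ weakly in $L^2_\sigma$ as $\tau\searrow0$ (essential limit). Claim. Let $(v,\xi)$ be an energy-variational solution, let $0<s<t<T$, and assume $\xi(\tau)=0$ for a.e. $\tau\in(s,t)$. Then there is a null set $N\subset\mathbb R$ such that for all $q<r$ in $(s,t)\setminus N$ $$\tfrac12\|v(r)\|_{L^2}^2-\tfrac12\|v(q)\|_{L^2}^2+\int_q^r\big(\nu\|\nabla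 v\|_{L^2}^2-\langle f,v\rangle\big)\,d\tau\le0,$$ and for every $\varphi\in C^1_c((s,t);C^\infty_{c,\sigma}(\Omega))$ $$\int_s^t\big(\nu(\nabla v,\nabla\varphi)-(v\otimes v;\nabla\varphi)-(v,\partial_t\varphi)-\langle f,\varphi\rangle\big)\,d\tau=0 .$$ -/

import Mathlib

open MeasureTheory Set Filter Topology
open scoped ENNReal ContDiff

noncomputable section

namespace EnergyVariational

/-- Euclidean space `ℝᵈ`. -/
abbrev Eu (d : ℕ) : Type := EuclideanSpace ℝ (Fin d)

/-- `L²(Ω; ℝ^ι)` with the Euclidean norm on `ℝ^ι`. -/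
abbrev L2 {d : ℕ} (Ω : Set (Eu d)) (ι : Type) [Fintype ι] : Type :=
  Lp (EuclideanSpace ℝ ι) 2 (volume.restrict Ω)

/-- Lebesgue measure on the time interval `(0,T)`. -/
abbrev timeMeasure (T : ℝ) : Measure ℝ := volume.restrict (Ioo 0 T)

/-! ### Smooth functions and weak derivatives -/

/-- The classical gradient (Jacobian) of a vector field; the entry `(i, j)` is `∂ⱼ φᵢ`.
As an element of `EuclideanSpace` it carries the Frobenius inner product. -/
def grad {d : ℕ} (φ : Eu d → Eu d) (x : Eu d) : EuclideanSpace ℝ (Fin d × Fin d) :=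
  WithLp.toLp 2 fun p => (fderiv ℝ φ x (EuclideanSpace.single p.2 1)) p.1

/-- The classical divergence of a vector field. -/
def diverg {d : ℕ} (φ : Eu d → Eu d) (x : Eu d) : ℝ :=
  ∑ i, grad φ x (i, i)

/-- `C_c^∞(Ω; F)`. -/
def IsTest {d : ℕ} (Ω : Set (Eu d)) {F : Type} [NormedAddCommGroup F] [NormedSpace ℝ F]
    (φ : Eu d → F) : Prop :=
  ContDiff ℝ ∞ φ ∧ HasCompactSupport φ ∧ tsupport φ ⊆ Ω

/-- `C_{c,σ}^∞(Ω; ℝᵈ)`: smooth solenoidal vector fields with compact support in `Ω`. -/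
def IsSolTest {d : ℕ} (Ω : Set (Eu d)) (φ : Eu d → Eu d) : Prop :=
  IsTest Ω φ ∧ ∀ x, diverg φ x = 0

/-- `G` is the weak gradient of `u` in `Ω`; the entry `(i, j)` is `∂ⱼ uᵢ`. -/
def IsWeakGrad {d : ℕ} (Ω : Set (Eu d)) {ι : Type} [Fintype ι]
    (u : L2 Ω ι) (G : L2 Ω (ι × Fin d)) : Prop :=
  ∀ η : Eu d → ℝ, IsTest Ω η → ∀ (i : ι) (j : Fin d),
    ∫ x in Ω, u x i * fderiv ℝ η x (EuclideanSpace.single j 1) =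
      - ∫ x in Ω, G x (i, j) * η x

open Classical in
/-- The weak gradient of `u` if `u` has one in `L²(Ω)`, and `0` otherwise. -/
def weakGrad {d : ℕ} (Ω : Set (Eu d)) {ι : Type} [Fintype ι] (u : L2 Ω ι) :
    L2 Ω (ι × Fin d) :=
  if h : ∃ G, IsWeakGrad Ω u G then h.choose else 0

/-! ### Function spaces on `Ω` -/

/-- `L²_σ(Ω)`: the closure of `C_{c,σ}^∞(Ω; ℝᵈ)` in `L²(Ω)`. -/
def L2sol {d : ℕ} (Ω : Set (Eu d)) : Submodule ℝ (L2 Ω (Fin d)) :=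
  (Submodule.span ℝ {u : L2 Ω (Fin d) | ∃ φ : Eu d → Eu d, IsSolTest Ω φ ∧
    u =ᵐ[volume.restrict Ω] φ}).topologicalClosure

/-- `H¹₀(Ω; ℝᵈ)`: the closure of `C_c^∞(Ω; ℝᵈ)` in `H¹`, where `u ∈ H¹` is identified with
`(u, ∇u) ∈ L² × L²` (the product norm is equivalent to the `H¹`-norm). -/
def H10 {d : ℕ} (Ω : Set (Eu d)) : Submodule ℝ (L2 Ω (Fin d) × L2 Ω (Fin d × Fin d)) :=
  (Submodule.span ℝ {p : L2 Ω (Fin d) × L2 Ω (Fin d × Fin d) | ∃ φ : Eu d → Eu d,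
    IsTest Ω φ ∧ p.1 =ᵐ[volume.restrict Ω] φ ∧
      p.2 =ᵐ[volume.restrict Ω] grad φ}).topologicalClosure

/-- `H¹_{0,σ}(Ω)`: the closure of `C_{c,σ}^∞(Ω; ℝᵈ)` in `H¹`, again as pairs `(u, ∇u)`. -/
def H10sol {d : ℕ} (Ω : Set (Eu d)) : Submodule ℝ (L2 Ω (Fin d) × L2 Ω (Fin d × Fin d)) :=
  (Submodule.span ℝ {p : L2 Ω (Fin d) × L2 Ω (Fin d × Fin d) | ∃ φ : Eu d → Eu d,
    IsSolTest Ω φ ∧ p.1 =ᵐ[volume.restrict Ω] φ ∧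
      p.2 =ᵐ[volume.restrict Ω] grad φ}).topologicalClosure

/-- `H⁻¹(Ω)`, the dual space of `H¹₀(Ω; ℝᵈ)`. -/
abbrev Hm1 {d : ℕ} (Ω : Set (Eu d)) : Type := StrongDual ℝ (H10 Ω)

open Classical in
/-- The duality pairing `⟨F, u⟩` of `H⁻¹(Ω)` and `H¹₀(Ω)` (junk value `0` if `u ∉ H¹₀(Ω)`). -/
def hm1Pair {d : ℕ} {Ω : Set (Eu d)} (F : Hm1 Ω) (u : L2 Ω (Fin d)) : ℝ :=
  if h : (u, weakGrad Ω u) ∈ H10 Ω then F ⟨(u, weakGrad Ω u), h⟩ else 0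

/-- The pairing of an element of `H⁻¹(Ω) ⊕ L²(Ω)` with a vector field. -/
def forcePair {d : ℕ} {Ω : Set (Eu d)} (F : Hm1 Ω × L2 Ω (Fin d)) (u : L2 Ω (Fin d)) : ℝ :=
  hm1Pair F.1 u + inner ℝ F.2 u

open Classical in
/-- The class in `L²(Ω; ℝᵈ)` of a square integrable vector field. -/
def toL2 {d : ℕ} (Ω : Set (Eu d)) (φ : Eu d → Eu d) : L2 Ω (Fin d) :=
  if h : MemLp φ 2 (volume.restrict Ω) then h.toLp φ else 0

/-! ### Functions of time and space -/

/-- The pointwise time derivative `∂ₜφ`. -/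
def timeDeriv {d : ℕ} (φ : ℝ → Eu d → Eu d) (τ : ℝ) (x : Eu d) : Eu d :=
  deriv (fun σ => φ σ x) τ

/-- `C¹(ℝ; C_{c,σ}^∞(Ω; ℝᵈ))` with supports in one compact subset of `Ω`: all spatial derivatives
of `φ` are differentiable in time, and the results are the spatial derivatives of `∂ₜφ`, which are
jointly continuous. (On a compact set of times this is continuous differentiability with respect
to the usual topology of `C_c^∞(Ω)`.) -/
structure IsC1Sol {d : ℕ} (Ω : Set (Eu d)) (φ : ℝ → Eu d → Eu d) : Prop where
  support : ∃ C : Set (Eu d), IsCompact C ∧ C ⊆ Ω ∧ ∀ τ, ∀ x ∉ C, φ τ x = 0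
  smooth : ∀ τ, ContDiff ℝ ∞ (φ τ)
  solenoidal : ∀ τ x, diverg (φ τ) x = 0
  smooth_timeDeriv : ∀ τ, ContDiff ℝ ∞ (timeDeriv φ τ)
  hasDerivAt : ∀ (n : ℕ) (τ : ℝ) (x : Eu d),
    HasDerivAt (fun σ => iteratedFDeriv ℝ n (φ σ) x) (iteratedFDeriv ℝ n (timeDeriv φ τ) x) τ
  continuous : ∀ n : ℕ,
    Continuous fun p : ℝ × Eu d => iteratedFDeriv ℝ n (timeDeriv φ p.1) p.2

/-- `C¹_c((s,t); C_{c,σ}^∞(Ω; ℝᵈ))`. -/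
def IsC1cSol {d : ℕ} (Ω : Set (Eu d)) (s t : ℝ) (φ : ℝ → Eu d → Eu d) : Prop :=
  IsC1Sol Ω φ ∧ ∃ J : Set ℝ, IsCompact J ∧ J ⊆ Ioo s t ∧ ∀ τ ∉ J, ∀ x, φ τ x = 0

/-- `u ∈ C¹([0,T]; C_{c,σ}^∞(Ω; ℝᵈ))`. -/
def IsC1SolOn {d : ℕ} (Ω : Set (Eu d)) (T : ℝ) (u : ℝ → L2sol Ω) : Prop :=
  ∃ φ : ℝ → Eu d → Eu d, IsC1Sol Ω φ ∧
    ∀ τ ∈ Icc 0 T, (u τ : L2 Ω (Fin d)) =ᵐ[volume.restrict Ω] φ τ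

/-- The energy space: `L^∞(0,T; L²_σ) ∩ L²(0,T; H¹_{0,σ})` for `ν > 0`, and
`L^∞(0,T; L²_σ)` for `ν = 0`. -/
structure MemX {d : ℕ} (Ω : Set (Eu d)) (T ν : ℝ) (v : ℝ → L2sol Ω) : Prop where
  bounded : MemLp v ⊤ (timeMeasure T)
  mem_H10sol : 0 < ν → ∀ᵐ τ ∂(timeMeasure T),
    ((v τ : L2 Ω (Fin d)), weakGrad Ω (v τ : L2 Ω (Fin d))) ∈ H10sol Ω
  grad_memLp : 0 < ν →
    MemLp (fun τ => weakGrad Ω (v τ : L2 Ω (Fin d))) 2 (timeMeasure T)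

/-- The space of test functions: `X ∩ L²(0,T; H²) ∩ L¹(0,T; W^{1,∞}) ∩ H¹(0,T; (L²_σ)^*)`
for `ν > 0`, and the same without `L²(0,T; H²)` for `ν = 0`.
Here `w` is the weak time derivative of `u`, with `(L²_σ)^* ≅ L²_σ`, and `u` is the continuous
representative. A function with values in `W^{1,∞}` is given by the pair `(V, D)` of the
function and its gradient, both in `L^∞(Ω)`. -/
structure MemY {d : ℕ} (Ω : Set (Eu d)) (T ν : ℝ) (u w : ℝ → L2sol Ω) : Prop where
  memX : MemX Ω T ν u
  hasWeakGrad : ∀ᵐ τ ∂(timeMeasure T),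
    IsWeakGrad Ω (u τ : L2 Ω (Fin d)) (weakGrad Ω (u τ : L2 Ω (Fin d)))
  hasWeakGrad_two : 0 < ν → ∀ᵐ τ ∂(timeMeasure T),
    IsWeakGrad Ω (weakGrad Ω (u τ : L2 Ω (Fin d)))
      (weakGrad Ω (weakGrad Ω (u τ : L2 Ω (Fin d))))
  memLp_two : 0 < ν →
    MemLp (fun τ => weakGrad Ω (weakGrad Ω (u τ : L2 Ω (Fin d)))) 2 (timeMeasure T)
  lipschitz : ∃ (V : ℝ → Lp (Eu d) ⊤ (volume.restrict Ω))
      (D : ℝ → Lp (EuclideanSpace ℝ (Fin d × Fin d)) ⊤ (volume.restrict Ω)),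
    MemLp V 1 (timeMeasure T) ∧ MemLp D 1 (timeMeasure T) ∧
    ∀ᵐ τ ∂(timeMeasure T),
      V τ =ᵐ[volume.restrict Ω] (u τ : L2 Ω (Fin d)) ∧
      D τ =ᵐ[volume.restrict Ω] weakGrad Ω (u τ : L2 Ω (Fin d))
  timeDeriv_memLp : MemLp w 2 (timeMeasure T)
  hasTimeDeriv : ∀ t ∈ Icc 0 T, u t = u 0 + ∫ τ in (0 : ℝ)..t, w τ

/-- The space of right-hand sides: `L²(0,T; H⁻¹) ⊕ L¹(0,T; L²)` for `ν > 0`, and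
`L¹(0,T; L²)` for `ν = 0`. -/
structure MemZ {d : ℕ} (Ω : Set (Eu d)) (T ν : ℝ) (f : ℝ → Hm1 Ω × L2 Ω (Fin d)) : Prop where
  fst_memLp : MemLp (fun τ => (f τ).1) 2 (timeMeasure T)
  snd_memLp : MemLp (fun τ => (f τ).2) 1 (timeMeasure T)
  fst_eq_zero : ν = 0 → ∀ᵐ τ ∂(timeMeasure T), (f τ).1 = 0

/-! ### The relative energy, the system operator and the relative form -/

/-- The relative energy `R(v | u) = ½ ‖v - u‖²`. -/
def relEnergy {d : ℕ} {Ω : Set (Eu d)} (v u : L2sol Ω) : ℝ := 1 / 2 * ‖v - u‖ ^ 2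

/-- `∫_Ω (a · ∇) b · c dx`, where `G = ∇b`. -/
def convForm {d : ℕ} {Ω : Set (Eu d)} (a : L2 Ω (Fin d)) (G : L2 Ω (Fin d × Fin d))
    (c : L2 Ω (Fin d)) : ℝ :=
  ∫ x in Ω, ∑ i, ∑ j, a x j * G x (i, j) * c x i

/-- `∫_Ω aᵀ (G)_sym a dx`. -/
def symForm {d : ℕ} {Ω : Set (Eu d)} (a : L2 Ω (Fin d)) (G : L2 Ω (Fin d × Fin d)) : ℝ :=
  ∫ x in Ω, ∑ i, ∑ j, a x i * ((G x (i, j) + G x (j, i)) / 2) * a x j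

/-- `∫_Ω Δu · c dx`. -/
def laplaceForm {d : ℕ} {Ω : Set (Eu d)} (u c : L2 Ω (Fin d)) : ℝ :=
  ∫ x in Ω, ∑ i, ∑ j, weakGrad Ω (weakGrad Ω u) x ((i, j), j) * c x i

/-- `⟨A_ν(u), c⟩ = ⟨∂ₜu + (u · ∇)u - νΔu - f, c⟩` at a fixed time, with `w = ∂ₜu`. -/
def systemOp {d : ℕ} {Ω : Set (Eu d)} (ν : ℝ) (F : Hm1 Ω × L2 Ω (Fin d))
    (u w c : L2 Ω (Fin d)) : ℝ :=
  inner ℝ w c + convForm u (weakGrad Ω u) c - ν * laplaceForm u c - forcePair F c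

open Classical in
/-- The relative form `W_ν(v | u)` at a fixed time. -/
def relForm {d : ℕ} {Ω : Set (Eu d)} (ν : ℝ) (K : L2sol Ω → ℝ≥0∞) (v u : L2sol Ω) : ℝ :=
  (if ν = 0 then
    symForm ((v - u : L2sol Ω) : L2 Ω (Fin d)) (weakGrad Ω (u : L2 Ω (Fin d)))
  else
    ν * ‖weakGrad Ω (v : L2 Ω (Fin d)) - weakGrad Ω (u : L2 Ω (Fin d))‖ ^ 2
      - convForm ((v - u : L2sol Ω) : L2 Ω (Fin d))
          (weakGrad Ω (v : L2 Ω (Fin d)) - weakGrad Ω (u : L2 Ω (Fin d))) u)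
  + (K u).toReal * relEnergy v u

/-! ### Admissible regularity measures -/

/-- The domain `D(K) = {u ∈ X | K(u) ∈ L¹(0,T)}`. -/
def KDomain {d : ℕ} (Ω : Set (Eu d)) (T ν : ℝ) (K : L2sol Ω → ℝ≥0∞) :
    Set (ℝ → L2sol Ω) :=
  {u | MemX Ω T ν u ∧ AEMeasurable (fun τ => K (u τ)) (timeMeasure T) ∧
    ∫⁻ τ, K (u τ) ∂(timeMeasure T) ≠ ⊤}

/-- `K` as a map from `D(K)` to `L¹(0,T)`. -/
def KMap {d : ℕ} (Ω : Set (Eu d)) (T ν : ℝ) (K : L2sol Ω → ℝ≥0∞)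
    (u : KDomain Ω T ν K) : Lp ℝ 1 (timeMeasure T) :=
  (integrable_toReal_of_lintegral_ne_top u.2.2.1 u.2.2.2).toL1
    (fun τ => (K ((u : ℝ → L2sol Ω) τ)).toReal)

/-- Admissibility of `K : L²_σ(Ω) → [0,∞]`: `K(0) = 0`; for some topology on `D(K)` the map `K` is
continuous and `C¹([0,T]; C_{c,σ}^∞(Ω))` is a dense subset of `D(K)`; and `W_ν ≥ 0`. -/
structure IsAdmissible {d : ℕ} (Ω : Set (Eu d)) (T ν : ℝ) (K : L2sol Ω → ℝ≥0∞) : Prop where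
  map_zero : K 0 = 0
  subset_domain : ∀ u, IsC1SolOn Ω T u → u ∈ KDomain Ω T ν K
  exists_topology : ∃ 𝒯 : TopologicalSpace (KDomain Ω T ν K),
    @Continuous _ _ 𝒯 _ (KMap Ω T ν K) ∧
    @Dense _ 𝒯 {u : KDomain Ω T ν K | IsC1SolOn Ω T (u : ℝ → L2sol Ω)}
  relForm_nonneg : ∀ v, MemX Ω T ν v → ∀ u w, MemY Ω T ν u w → u ∈ KDomain Ω T ν K →
    ∀ᵐ τ ∂(timeMeasure T), 0 ≤ relForm ν K (v τ) (u τ)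

/-! ### Energy-variational solutions -/

/-- The filter of the (essential) limit `t+`, with the inner one-sided limit at the end point
`T`. -/
def rightLim (T t : ℝ) : Filter ℝ := (if t < T then 𝓝[>] t else 𝓝[<] t) ⊓ ae volume

/-- The filter of the (essential) limit `s-`, with the inner one-sided limit at the end point
`0`. -/
def leftLim (s : ℝ) : Filter ℝ := (if 0 < s then 𝓝[<] s else 𝓝[>] s) ⊓ ae volume

/-- `(v, ξ)` is an energy-variational solution on `(0,T)` with viscosity `ν`, right-hand side `f`
and initial value `v₀`. The values `R(v(t+) | u(t)) + ξ(t+)` and `R(v(s-) | u(s)) + ξ(s-)` are the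
one-sided limits `a` and `b` of the sum. -/
structure IsSolution {d : ℕ} (Ω : Set (Eu d)) (T ν : ℝ) (f : ℝ → Hm1 Ω × L2 Ω (Fin d))
    (v₀ : L2sol Ω) (v : ℝ → L2sol Ω) (ξ : ℝ → ℝ) : Prop where
  memX : MemX Ω T ν v
  memLp : MemLp ξ ⊤ (timeMeasure T)
  nonneg : ∀ t ∈ Ioo 0 T, 0 ≤ ξ t
  relative_energy : ∀ K : L2sol Ω → ℝ≥0∞, IsAdmissible Ω T ν K →
    ∀ u w, MemY Ω T ν u w → u ∈ KDomain Ω T ν K →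
    ∀ s t, 0 ≤ s → s ≤ t → t ≤ T →
    ∃ a b : ℝ,
      Tendsto (fun τ => relEnergy (v τ) (u t) + ξ τ) (rightLim T t) (𝓝 a) ∧
      Tendsto (fun τ => relEnergy (v τ) (u s) + ξ τ) (leftLim s) (𝓝 b) ∧
      a + ∫ τ in s..t, (relForm ν K (v τ) (u τ)
          + systemOp ν (f τ) (u τ) (w τ) ((v τ - u τ : L2sol Ω) : L2 Ω (Fin d))
          - (K (u τ)).toReal * (relEnergy (v τ) (u τ) + ξ τ)) ≤ b
  initial : ∀ c : L2sol Ω,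
    Tendsto (fun τ => inner ℝ (v τ) c) (𝓝[>] 0 ⊓ ae volume) (𝓝 (inner ℝ v₀ c))

end EnergyVariational

end

open MeasureTheory Set Filter Topology
open scoped ENNReal ContDiff

noncomputable section

namespace EnergyVariational

/-! ### Weak gradients -/

section WeakGradients

variable {d : ℕ} {Ω : Set (Eu d)} {ι : Type} [Fintype ι]

/-! The defining inequality is tested with a smooth solenoidal curve `u` that vanishes at both ends
of a time interval on which `ξ = 0` a.e. The terms with `K` then cancel. Since `v` and `u` are
solenoidal, the convective form is skew, `∫ (a·∇)b·u = -∫ (a·∇)u·b`, and the rest of the integrand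
collapses to

(dissipation and power of `v`) - (weak formulation of `v` against `u`) - `⟨∂ₜu, u⟩`

(`relForm_add_systemOp_sub`). The last term is the time derivative of `½‖u‖²` and integrates to
zero. The two boundary values are one-sided limits of `½‖v‖² + ξ`, the same for every such `u`. This
leaves `a + C - I(u) ≤ b` with `a`, `b`, `C` independent of `u` and `I` homogeneous in `u`
(`IsSolution.energy_le_of_isC1Sol`).

Replacing `u` by `c • u` with arbitrary real `c` forces `I(u) = 0`, which is the weak formulation.
With `u = 0` the inequality is the energy inequality between one-sided limits. By Lebesgue
differentiation, such limits agree with the values of `½‖v‖² + ξ` off a null set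
(`ae_eq_of_tendsto_inf_ae`).

The inequality is available only for admissible `K`, so an admissible `K` with all smooth curves in
its domain has to be produced (`isAdmissible_regMeasure`). A multiple of the `W^{1,∞}`-norm (`ν =
0`) or of its square (`ν > 0`) makes `W_ν ≥ 0` by Hölder and Young. The topology on its domain is
the one induced by `K` itself, so that density becomes an approximation problem for nonnegative
functions in `L¹(0,T)`. The remaining work is to show that the smooth curves belong to the test
space and that all integrands are integrable. -/

theorem IsTest.memLp {F : Type} [NormedAddCommGroup F] [NormedSpace ℝ F]
    {φ : Eu d → F} (hφ : IsTest Ω φ) (p : ℝ≥0∞) :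
    MemLp φ p (volume.restrict Ω) :=
  (hφ.1.continuous.memLp_of_hasCompactSupport hφ.2.1).restrict Ω

theorem IsTest.fderiv_apply {F : Type} [NormedAddCommGroup F] [NormedSpace ℝ F]
    {φ : Eu d → F} (hφ : IsTest Ω φ) (e : Eu d) :
    IsTest Ω (fun x => fderiv ℝ φ x e) := by
  refine ⟨?_, ?_, ?_⟩
  · exact (hφ.1.fderiv_right (m := ∞) (by simp)).clm_apply contDiff_const
  · exact hφ.2.1.fderiv_apply ℝ e
  · refine (closure_mono ?_).trans ((tsupport_fderiv_subset ℝ).trans hφ.2.2)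
    intro x hx
    simp only [Function.mem_support] at hx ⊢
    intro h
    exact hx (by simp [h])

theorem IsTest.coord {φ : Eu d → EuclideanSpace ℝ ι} (hφ : IsTest Ω φ) (i : ι) :
    IsTest Ω (fun x => φ x i) := by
  have h : (fun x => φ x i) = (EuclideanSpace.proj (𝕜 := ℝ) i) ∘ φ := rfl
  refine ⟨?_, ?_, ?_⟩
  · rw [h]
    exact (EuclideanSpace.proj (𝕜 := ℝ) i).contDiff.comp hφ.1
  · rw [h]
    exact hφ.2.1.comp_left (map_zero _)
  · rw [h]
    exact (tsupport_comp_subset (map_zero _) φ).trans hφ.2.2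

theorem IsTest.mul {η ζ : Eu d → ℝ} (hη : IsTest Ω η) (hζ : IsTest Ω ζ) :
    IsTest Ω (fun x => η x * ζ x) :=
  ⟨hη.1.mul hζ.1, hη.2.1.mul_right, (tsupport_mul_subset_left).trans hη.2.2⟩

/-- Both sides of the identity in `IsWeakGrad` become inner products with fixed elements, so its
linearity and its closedness in `L² × L²` need no separate integrability arguments. -/
theorem exists_inner_eq_integral_coord {η : Eu d → ℝ} (hη : MemLp η 2 (volume.restrict Ω)) (i : ι) :
    ∃ h : L2 Ω ι, ∀ u : L2 Ω ι, inner ℝ u h = ∫ x in Ω, u x i * η x := by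
  classical
  have hm : MemLp (fun x => EuclideanSpace.single i (η x) : Eu d → EuclideanSpace ℝ ι) 2
      (volume.restrict Ω) := by
    have : (fun x => EuclideanSpace.single i (η x) : Eu d → EuclideanSpace ℝ ι)
        = fun x => η x • EuclideanSpace.single i (1 : ℝ) := by
      ext x j
      simp
    rw [this]
    refine MemLp.of_le_mul (c := ‖(EuclideanSpace.single i (1 : ℝ) : EuclideanSpace ℝ ι)‖) hη
      (hη.1.smul_const _) ?_
    exact .of_forall fun x => by rw [norm_smul, mul_comm]
  refine ⟨hm.toLp _, fun u => ?_⟩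
  rw [L2.inner_def]
  refine integral_congr_ae ?_
  filter_upwards [hm.coeFn_toLp] with x hx
  simp only [hx, EuclideanSpace.inner_single_right]
  simp [mul_comm]

theorem integrableOn_coord_mul {η : Eu d → ℝ} (hη : MemLp η 2 (volume.restrict Ω))
    (u : L2 Ω ι) (i : ι) : IntegrableOn (fun x => u x i * η x) Ω := by
  have hu : MemLp (fun x => u x i) 2 (volume.restrict Ω) :=
    (EuclideanSpace.proj (𝕜 := ℝ) i).comp_memLp' (Lp.memLp u)
  exact hu.integrable_mul hη

/-- The graph of the weak gradient as a subspace of `L² × L²`. -/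
def weakGradGraph (Ω : Set (Eu d)) (ι : Type) [Fintype ι] :
    Submodule ℝ (L2 Ω ι × L2 Ω (ι × Fin d)) :=
  Submodule.mk ⟨⟨{p | IsWeakGrad Ω p.1 p.2}, by
      intro p q hp hq η hη i j
      obtain ⟨h₁, H₁⟩ := exists_inner_eq_integral_coord
        ((hη.fderiv_apply (EuclideanSpace.single j 1)).memLp 2) i
      obtain ⟨h₂, H₂⟩ := exists_inner_eq_integral_coord (hη.memLp 2) (i, j)
      have hp' := hp η hη i j
      have hq' := hq η hη i j
      rw [← H₁, ← H₂] at hp' hq' ⊢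
      rw [Prod.fst_add, Prod.snd_add, inner_add_left, inner_add_left, hp', hq']
      ring⟩, by
      intro η hη i j
      obtain ⟨h₁, H₁⟩ := exists_inner_eq_integral_coord
        ((hη.fderiv_apply (EuclideanSpace.single j 1)).memLp 2) i
      obtain ⟨h₂, H₂⟩ := exists_inner_eq_integral_coord (hη.memLp 2) (i, j)
      rw [← H₁, ← H₂]
      simp⟩ (by
      intro c p hp η hη i j
      obtain ⟨h₁, H₁⟩ := exists_inner_eq_integral_coord
        ((hη.fderiv_apply (EuclideanSpace.single j 1)).memLp 2) i
      obtain ⟨h₂, H₂⟩ := exists_inner_eq_integral_coord (hη.memLp 2) (i, j)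
      have hp' := hp η hη i j
      rw [← H₁, ← H₂] at hp' ⊢
      rw [Prod.smul_fst, Prod.smul_snd, real_inner_smul_left, real_inner_smul_left, hp']
      ring)

theorem isClosed_weakGradGraph :
    IsClosed (weakGradGraph Ω ι : Set (L2 Ω ι × L2 Ω (ι × Fin d))) := by
  have : (weakGradGraph Ω ι : Set (L2 Ω ι × L2 Ω (ι × Fin d))) =
      ⋂ (η : Eu d → ℝ) (_ : IsTest Ω η) (i : ι) (j : Fin d),
        {p | ∫ x in Ω, p.1 x i * fderiv ℝ η x (EuclideanSpace.single j 1) =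
          - ∫ x in Ω, p.2 x (i, j) * η x} := by
    ext p
    simp only [mem_iInter, mem_ofPred_eq]
    rfl
  rw [this]
  refine isClosed_iInter fun η => isClosed_iInter fun hη => isClosed_iInter fun i =>
    isClosed_iInter fun j => ?_
  obtain ⟨h₁, H₁⟩ := exists_inner_eq_integral_coord
    ((hη.fderiv_apply (EuclideanSpace.single j 1)).memLp 2) i
  obtain ⟨h₂, H₂⟩ := exists_inner_eq_integral_coord (hη.memLp 2) (i, j)
  simp only [← H₁, ← H₂]
  exact isClosed_eq (continuous_fst.inner continuous_const)
    (continuous_snd.inner continuous_const).neg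

theorem IsWeakGrad.sub {u u' : L2 Ω ι} {G G' : L2 Ω (ι × Fin d)} (h : IsWeakGrad Ω u G)
    (h' : IsWeakGrad Ω u' G') : IsWeakGrad Ω (u - u') (G - G') :=
  (weakGradGraph Ω ι).sub_mem (x := (u, G)) (y := (u', G')) h h'

theorem IsWeakGrad.const_smul {u : L2 Ω ι} {G : L2 Ω (ι × Fin d)} (h : IsWeakGrad Ω u G) (c : ℝ) :
    IsWeakGrad Ω (c • u) (c • G) :=
  (weakGradGraph Ω ι).smul_mem c (x := (u, G)) h

theorem isWeakGrad_zero : IsWeakGrad Ω (0 : L2 Ω ι) 0 :=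
  (weakGradGraph Ω ι).zero_mem

/-- The fundamental lemma of the calculus of variations, applied to each entry of the difference. It
makes the choice in the definition of `weakGrad` immaterial. -/
theorem IsWeakGrad.unique (hΩ : IsOpen Ω) {u : L2 Ω ι} {G G' : L2 Ω (ι × Fin d)}
    (h : IsWeakGrad Ω u G) (h' : IsWeakGrad Ω u G') : G = G' := by
  have h0 : IsWeakGrad Ω 0 (G - G') := by simpa using h.sub h'
  rw [← sub_eq_zero]
  refine Lp.ext ?_
  have key : ∀ p : ι × Fin d, ∀ᵐ x, x ∈ Ω → (G - G') x p = 0 := by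
    rintro ⟨i, j⟩
    refine hΩ.ae_eq_zero_of_integral_contDiff_smul_eq_zero ?_ ?_
    · have hm : MemLp (fun x => (G - G') x (i, j)) 2 (volume.restrict Ω) :=
        (EuclideanSpace.proj (𝕜 := ℝ) (i, j)).comp_memLp' (Lp.memLp (G - G'))
      rw [locallyIntegrableOn_iff hΩ.isLocallyClosed]
      intro k hk hkc
      have : IsFiniteMeasure (volume.restrict k) := ⟨by simpa using hkc.measure_lt_top⟩
      exact (hm.mono_measure (Measure.restrict_mono hk le_rfl)).integrable (by norm_num)
    · intro g hg hgc hgs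
      have hgt : IsTest Ω g := ⟨hg, hgc, hgs⟩
      have := h0 g hgt i j
      have h1 : ∫ x in Ω, (0 : L2 Ω ι) x i * fderiv ℝ g x (EuclideanSpace.single j 1) = 0 := by
        rw [integral_congr_ae (g := fun _ => (0 : ℝ))]
        · simp
        · filter_upwards [Lp.coeFn_zero (EuclideanSpace ℝ ι) 2 (volume.restrict Ω)] with x hx
          rw [hx]
          simp
      rw [h1, eq_comm, neg_eq_zero] at this
      rw [← this, ← setIntegral_eq_integral_of_forall_compl_eq_zero (s := Ω)]
      · simp only [smul_eq_mul, mul_comm]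
      · intro x hx
        have : g x = 0 := image_eq_zero_of_notMem_tsupport fun hx' => hx (hgs hx')
        simp [this]
  have := (ae_restrict_iff' hΩ.measurableSet).2 (eventually_countable_forall.2 key |>.mono
    fun x hx hxΩ p => hx p hxΩ)
  filter_upwards [this, Lp.coeFn_zero (EuclideanSpace ℝ (ι × Fin d)) 2 (volume.restrict Ω)]
    with x hx h0
  rw [h0]
  ext p
  simpa using hx p

theorem IsWeakGrad.isWeakGrad_weakGrad {u : L2 Ω ι} {G : L2 Ω (ι × Fin d)}
    (h : IsWeakGrad Ω u G) : IsWeakGrad Ω u (weakGrad Ω u) := by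
  classical
  have hex : ∃ G, IsWeakGrad Ω u G := ⟨G, h⟩
  rw [weakGrad, dif_pos hex]
  exact hex.choose_spec

theorem IsWeakGrad.weakGrad_eq (hΩ : IsOpen Ω) {u : L2 Ω ι} {G : L2 Ω (ι × Fin d)}
    (h : IsWeakGrad Ω u G) : weakGrad Ω u = G :=
  h.isWeakGrad_weakGrad.unique hΩ h

theorem weakGrad_zero (hΩ : IsOpen Ω) : weakGrad Ω (0 : L2 Ω ι) = 0 :=
  isWeakGrad_zero.weakGrad_eq hΩ

-- No differentiability of `u` is required: for `c ≠ 0` the fields `u` and `c • u` have weak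
-- gradients or lack them together, and in the second case both default values are `0`.
open Classical in
theorem weakGrad_const_smul (hΩ : IsOpen Ω) (c : ℝ) (u : L2 Ω ι) :
    weakGrad Ω (c • u) = c • weakGrad Ω u := by
  rcases eq_or_ne c 0 with rfl | hc
  · simp [weakGrad_zero hΩ]
  by_cases h : ∃ G, IsWeakGrad Ω u G
  · obtain ⟨G, hG⟩ := h
    exact (hG.isWeakGrad_weakGrad.const_smul c).weakGrad_eq hΩ
  · have h' : ¬ ∃ G, IsWeakGrad Ω (c • u) G := by
      rintro ⟨G, hG⟩
      exact h ⟨c⁻¹ • G, by simpa [smul_smul, hc] using hG.const_smul c⁻¹⟩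
    rw [weakGrad, weakGrad, dif_neg h, dif_neg h', smul_zero]

/-- The classical gradient of a map into `ℝ^ι`; the entry `(i, j)` is `∂ⱼ gᵢ`. -/
def jacobian (g : Eu d → EuclideanSpace ℝ ι) (x : Eu d) : EuclideanSpace ℝ (ι × Fin d) :=
  WithLp.toLp 2 fun p => (fderiv ℝ g x (EuclideanSpace.single p.2 1)) p.1

theorem grad_eq_jacobian (φ : Eu d → Eu d) : grad φ = jacobian φ := rfl

theorem fderiv_coord {g : Eu d → EuclideanSpace ℝ ι} {x : Eu d} (hg : DifferentiableAt ℝ g x)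
    (i : ι) (e : Eu d) : fderiv ℝ (fun y => g y i) x e = fderiv ℝ g x e i := by
  have := ((EuclideanSpace.proj (𝕜 := ℝ) i).hasFDerivAt.comp x hg.hasFDerivAt).fderiv
  change fderiv ℝ (EuclideanSpace.proj (𝕜 := ℝ) i ∘ g) x e = _
  rw [this]
  rfl

theorem IsTest.jacobian {g : Eu d → EuclideanSpace ℝ ι} (hg : IsTest Ω g) :
    IsTest Ω (jacobian g) := by
  refine ⟨?_, ?_, ?_⟩
  · rw [contDiff_euclidean]
    rintro ⟨i, j⟩
    exact ((hg.fderiv_apply (EuclideanSpace.single j 1)).coord i).1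
  · refine (hg.2.1.fderiv ℝ).mono ?_
    intro x hx
    simp only [Function.mem_support] at hx ⊢
    intro h
    refine hx ?_
    ext p
    simp [EnergyVariational.jacobian, h]
  · refine (closure_mono ?_).trans ((tsupport_fderiv_subset ℝ).trans hg.2.2)
    intro x hx
    simp only [Function.mem_support] at hx ⊢
    intro h
    refine hx ?_
    ext p
    simp [EnergyVariational.jacobian, h]

theorem IsTest.isWeakGrad_of_ae_eq {g : Eu d → EuclideanSpace ℝ ι}
    (hg : IsTest Ω g) {u : L2 Ω ι} {G : L2 Ω (ι × Fin d)} (hu : u =ᵐ[volume.restrict Ω] g)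
    (hG : G =ᵐ[volume.restrict Ω] EnergyVariational.jacobian g) : IsWeakGrad Ω u G := by
  intro η hη i j
  have h1 : ∫ x in Ω, u x i * fderiv ℝ η x (EuclideanSpace.single j 1) =
      ∫ x, g x i * fderiv ℝ η x (EuclideanSpace.single j 1) := by
    have e := setIntegral_eq_integral_of_forall_compl_eq_zero (μ := volume) (s := Ω)
      (f := fun x => g x i * fderiv ℝ η x (EuclideanSpace.single j 1)) (by
        intro x hx
        have h0 : g x i = 0 :=
          image_eq_zero_of_notMem_tsupport (f := fun x => g x i)
            fun hx' => hx ((hg.coord i).2.2 hx')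
        rw [h0, zero_mul])
    rw [← e]
    refine integral_congr_ae ?_
    filter_upwards [hu] with x hx
    rw [hx]
  have h2 : ∫ x in Ω, G x (i, j) * η x =
      ∫ x, fderiv ℝ (fun y => g y i) x (EuclideanSpace.single j 1) * η x := by
    have e := setIntegral_eq_integral_of_forall_compl_eq_zero (μ := volume) (s := Ω)
      (f := fun x => fderiv ℝ (fun y => g y i) x (EuclideanSpace.single j 1) * η x) (by
        intro x hx
        rw [image_eq_zero_of_notMem_tsupport fun hx' => hx (hη.2.2 hx'), mul_zero])
    rw [← e]
    refine integral_congr_ae ?_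
    filter_upwards [hG] with x hx
    rw [hx, fderiv_coord (hg.1.differentiable (by simp) x)]
    rfl
  rw [h1, h2]
  have hgi := hg.coord i
  have hgi' := hgi.fderiv_apply (EuclideanSpace.single j 1)
  have hη' := hη.fderiv_apply (EuclideanSpace.single j 1)
  refine integral_mul_fderiv_eq_neg_fderiv_mul_of_integrable ?_ ?_ ?_ ?_ ?_
  · exact (hgi'.mul hη).1.continuous.integrable_of_hasCompactSupport (hgi'.mul hη).2.1
  · exact (hgi.mul hη').1.continuous.integrable_of_hasCompactSupport (hgi.mul hη').2.1
  · exact (hgi.mul hη).1.continuous.integrable_of_hasCompactSupport (hgi.mul hη).2.1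
  · exact fun x _ => hgi.1.differentiable (by simp) x
  · exact fun x _ => hη.1.differentiable (by simp) x

theorem IsTest.weakGrad_ae_eq (hΩ : IsOpen Ω) {g : Eu d → EuclideanSpace ℝ ι}
    (hg : IsTest Ω g) {u : L2 Ω ι} (hu : u =ᵐ[volume.restrict Ω] g) :
    IsWeakGrad Ω u (weakGrad Ω u) ∧
      weakGrad Ω u =ᵐ[volume.restrict Ω] EnergyVariational.jacobian g := by
  have hG := (hg.jacobian.memLp 2).coeFn_toLp
  have := hg.isWeakGrad_of_ae_eq hu hG
  exact ⟨this.isWeakGrad_weakGrad, by rw [this.weakGrad_eq hΩ]; exact hG⟩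

theorem H10sol_le_H10 : H10sol Ω ≤ H10 Ω := by
  refine Submodule.topologicalClosure_mono (Submodule.span_mono ?_)
  rintro p ⟨φ, hφ, h⟩
  exact ⟨φ, hφ.1, h⟩

/-- The generating pairs lie in the graph of the weak gradient, and the graph is closed. -/
theorem isWeakGrad_of_mem_H10 {p : L2 Ω (Fin d) × L2 Ω (Fin d × Fin d)} (hp : p ∈ H10 Ω) :
    IsWeakGrad Ω p.1 p.2 := by
  have : H10 Ω ≤ weakGradGraph Ω (Fin d) := by
    refine Submodule.topologicalClosure_minimal _ (Submodule.span_le.2 ?_) isClosed_weakGradGraph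
    rintro p ⟨φ, hφ, h1, h2⟩
    exact hφ.isWeakGrad_of_ae_eq h1 h2
  exact this hp

end WeakGradients

/-! ### The convective form -/

section ConvectiveForm

variable {d : ℕ} {Ω : Set (Eu d)}

/-- The contraction `(G, c) ↦ Gᵀ c`. -/
def contract (d : ℕ) : EuclideanSpace ℝ (Fin d × Fin d) →L[ℝ] Eu d →L[ℝ] Eu d :=
  (LinearMap.mk₂ ℝ (fun (G : EuclideanSpace ℝ (Fin d × Fin d)) (c : Eu d) =>
      (WithLp.toLp 2 fun j => ∑ i, G (i, j) * c i : Eu d))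
    (by intros; ext j; simp [add_mul, Finset.sum_add_distrib])
    (by intros; ext j; simp [mul_assoc, Finset.mul_sum])
    (by intros; ext j; simp [mul_add, Finset.sum_add_distrib])
    (by intros; ext j; simp [mul_left_comm, Finset.mul_sum])).toContinuousBilinearMap

theorem contract_apply (G : EuclideanSpace ℝ (Fin d × Fin d)) (c : Eu d) (j : Fin d) :
    contract d G c j = ∑ i, G (i, j) * c i := rfl

theorem inner_contract (a : Eu d) (G : EuclideanSpace ℝ (Fin d × Fin d)) (c : Eu d) :
    inner ℝ a (contract d G c) = ∑ i, ∑ j, a j * G (i, j) * c i := by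
  rw [PiLp.inner_apply, Finset.sum_comm]
  refine Finset.sum_congr rfl fun j _ => ?_
  simp only [contract_apply, RCLike.inner_apply, conj_trivial, Finset.sum_mul]
  exact Finset.sum_congr rfl fun i _ => by ring

theorem convForm_eq_integral_inner (a : L2 Ω (Fin d)) (G : L2 Ω (Fin d × Fin d))
    (c : L2 Ω (Fin d)) :
    convForm a G c = ∫ x in Ω, inner ℝ (a x) (contract d (G x) (c x)) := by
  simp only [inner_contract]
  rfl

/-- A product of three `L²` functions need not be integrable, so `convForm` is not trilinear in
general. Once one factor is bounded it is an `L²` inner product with a Hölder product. Linearity and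
bounds follow from this and the next lemma. -/
theorem convForm_eq_inner_of_bdd_right {c : L2 Ω (Fin d)} {V : Lp (Eu d) ⊤ (volume.restrict Ω)}
    (hV : V =ᵐ[volume.restrict Ω] c) (a : L2 Ω (Fin d)) (G : L2 Ω (Fin d × Fin d)) :
    convForm a G c = inner ℝ a ((contract d).flip.holder 2 V G) := by
  rw [convForm_eq_integral_inner, L2.inner_def]
  refine integral_congr_ae ?_
  filter_upwards [hV, (contract d).flip.coeFn_holder (r := 2) V G] with x h1 h2
  simp [h1, h2]

theorem convForm_eq_inner_of_bdd_mid {G : L2 Ω (Fin d × Fin d)}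
    {D : Lp (EuclideanSpace ℝ (Fin d × Fin d)) ⊤ (volume.restrict Ω)}
    (hD : D =ᵐ[volume.restrict Ω] G) (a c : L2 Ω (Fin d)) :
    convForm a G c = inner ℝ a ((contract d).holder 2 D c) := by
  rw [convForm_eq_integral_inner, L2.inner_def]
  refine integral_congr_ae ?_
  filter_upwards [hD, (contract d).coeFn_holder (r := 2) D c] with x h1 h2
  simp [h1, h2]

theorem symForm_eq_convForm (a : L2 Ω (Fin d)) (G : L2 Ω (Fin d × Fin d)) :
    symForm a G = convForm a G a := by
  unfold symForm convForm
  congr 1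
  ext x
  have h : ∑ i, ∑ j, a x i * G x (j, i) * a x j = ∑ i, ∑ j, a x i * G x (i, j) * a x j := by
    rw [Finset.sum_comm]
    exact Finset.sum_congr rfl fun i _ => Finset.sum_congr rfl fun j _ => by ring
  calc ∑ i, ∑ j, a x i * ((G x (i, j) + G x (j, i)) / 2) * a x j
      = (∑ i, ∑ j, a x i * G x (i, j) * a x j + ∑ i, ∑ j, a x i * G x (j, i) * a x j) / 2 := by
        rw [← Finset.sum_add_distrib, Finset.sum_div]
        refine Finset.sum_congr rfl fun i _ => ?_
        rw [← Finset.sum_add_distrib, Finset.sum_div]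
        exact Finset.sum_congr rfl fun j _ => by ring
    _ = ∑ i, ∑ j, a x i * G x (i, j) * a x j := by rw [h]; ring
    _ = _ := Finset.sum_congr rfl fun i _ => Finset.sum_congr rfl fun j _ => by ring

theorem abs_convForm_le_of_bdd_right {c : L2 Ω (Fin d)}
    (hc : MemLp c ⊤ (volume.restrict Ω)) (a : L2 Ω (Fin d)) (G : L2 Ω (Fin d × Fin d)) :
    |convForm a G c| ≤ ‖contract d‖ * (eLpNorm c ⊤ (volume.restrict Ω)).toReal * ‖a‖ * ‖G‖ := by
  rw [convForm_eq_inner_of_bdd_right hc.coeFn_toLp]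
  refine (abs_real_inner_le_norm _ _).trans ?_
  have := (contract d).flip.norm_holder_apply_apply_le (r := 2) hc.toLp G
  rw [ContinuousLinearMap.opNorm_flip, Lp.norm_toLp] at this
  nlinarith [norm_nonneg a]

theorem abs_convForm_le_of_bdd_mid {G : L2 Ω (Fin d × Fin d)}
    (hG : MemLp G ⊤ (volume.restrict Ω)) (a c : L2 Ω (Fin d)) :
    |convForm a G c| ≤ ‖contract d‖ * (eLpNorm G ⊤ (volume.restrict Ω)).toReal * ‖a‖ * ‖c‖ := by
  rw [convForm_eq_inner_of_bdd_mid hG.coeFn_toLp]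
  refine (abs_real_inner_le_norm _ _).trans ?_
  have := (contract d).norm_holder_apply_apply_le (r := 2) hG.toLp c
  rw [Lp.norm_toLp] at this
  nlinarith [norm_nonneg a]

theorem convForm_sub_left {c : L2 Ω (Fin d)} (hc : MemLp c ⊤ (volume.restrict Ω))
    (a a' : L2 Ω (Fin d)) (G : L2 Ω (Fin d × Fin d)) :
    convForm (a - a') G c = convForm a G c - convForm a' G c := by
  simp only [convForm_eq_inner_of_bdd_right hc.coeFn_toLp, inner_sub_left]

theorem convForm_sub_left_of_bdd_mid {G : L2 Ω (Fin d × Fin d)}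
    (hG : MemLp G ⊤ (volume.restrict Ω)) (a a' c : L2 Ω (Fin d)) :
    convForm (a - a') G c = convForm a G c - convForm a' G c := by
  simp only [convForm_eq_inner_of_bdd_mid hG.coeFn_toLp, inner_sub_left]

theorem convForm_sub_mid {c : L2 Ω (Fin d)} (hc : MemLp c ⊤ (volume.restrict Ω))
    (a : L2 Ω (Fin d)) (G G' : L2 Ω (Fin d × Fin d)) :
    convForm a (G - G') c = convForm a G c - convForm a G' c := by
  simp only [convForm_eq_inner_of_bdd_right hc.coeFn_toLp,
    ← ContinuousLinearMap.holderL_apply_apply, map_sub, inner_sub_right]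

theorem convForm_sub_right {G : L2 Ω (Fin d × Fin d)} (hG : MemLp G ⊤ (volume.restrict Ω))
    (a c c' : L2 Ω (Fin d)) :
    convForm a G (c - c') = convForm a G c - convForm a G c' := by
  simp only [convForm_eq_inner_of_bdd_mid hG.coeFn_toLp,
    ← ContinuousLinearMap.holderL_apply_apply, map_sub, inner_sub_right]

theorem IsSolTest.sum_fderiv {ψ : Eu d → Eu d} (hψ : IsSolTest Ω ψ) (x : Eu d) :
    ∑ j, fderiv ℝ (fun y => ψ y j) x (EuclideanSpace.single j 1) = 0 := by
  rw [← hψ.2 x]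
  refine Finset.sum_congr rfl fun j _ => ?_
  rw [fderiv_coord (hψ.1.1.differentiable (by simp) x)]
  rfl

/-- Integration by parts in the convective form for a solenoidal transporting field. -/
theorem convForm_eq_neg_of_isSolTest (hΩ : IsOpen Ω) {a : L2 Ω (Fin d)} {ψ : Eu d → Eu d}
    (hψ : IsSolTest Ω ψ) (ha : a =ᵐ[volume.restrict Ω] ψ)
    {b : L2 Ω (Fin d)} {G : L2 Ω (Fin d × Fin d)} (hb : IsWeakGrad Ω b G)
    {U : L2 Ω (Fin d)} {φ : Eu d → Eu d} (hφ : IsTest Ω φ) (hU : U =ᵐ[volume.restrict Ω] φ) :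
    convForm a G U = - convForm a (weakGrad Ω U) b := by
  -- The weak gradient of `b` is tested with `ψⱼ φᵢ`. Summed over `j`, the derivatives `∂ⱼ(ψⱼ φᵢ)`
  -- give `ψ · ∇φᵢ`, because `ψ` is solenoidal.
  have hη : ∀ i j, IsTest Ω (fun x => ψ x j * φ x i) := fun i j =>
    (hψ.1.coord j).mul (hφ.coord i)
  have hη' : ∀ i j, MemLp (fun x => fderiv ℝ (fun y => ψ y j * φ y i) x
      (EuclideanSpace.single j 1)) 2 (volume.restrict Ω) := fun i j =>
    ((hη i j).fderiv_apply _).memLp 2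
  have h1 : convForm a G U = ∑ i, ∑ j, ∫ x in Ω, G x (i, j) * (ψ x j * φ x i) := by
    rw [convForm, integral_congr_ae (g := fun x => ∑ i, ∑ j, G x (i, j) * (ψ x j * φ x i)),
      integral_finsetSum]
    · refine Finset.sum_congr rfl fun i _ => ?_
      rw [integral_finsetSum]
      exact fun j _ => integrableOn_coord_mul ((hη i j).memLp 2) G (i, j)
    · exact fun i _ => integrable_finsetSum _ fun j _ =>
        integrableOn_coord_mul ((hη i j).memLp 2) G (i, j)
    · filter_upwards [ha, hU] with x h1 h2
      rw [h1, h2]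
      exact Finset.sum_congr rfl fun i _ => Finset.sum_congr rfl fun j _ => by ring
  have h2 : convForm a (weakGrad Ω U) b = ∑ i, ∑ j, ∫ x in Ω, b x i *
      fderiv ℝ (fun y => ψ y j * φ y i) x (EuclideanSpace.single j 1) := by
    rw [convForm, integral_congr_ae (g := fun x => ∑ i, ∑ j, b x i *
      fderiv ℝ (fun y => ψ y j * φ y i) x (EuclideanSpace.single j 1)),
      integral_finsetSum]
    · refine Finset.sum_congr rfl fun i _ => ?_
      rw [integral_finsetSum]
      exact fun j _ => integrableOn_coord_mul (hη' i j) b i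
    · exact fun i _ => integrable_finsetSum _ fun j _ =>
        integrableOn_coord_mul (hη' i j) b i
    · filter_upwards [ha, (hφ.weakGrad_ae_eq hΩ hU).2] with x h1 h2
      rw [h1, h2]
      refine Finset.sum_congr rfl fun i _ => ?_
      have e : ∀ j, fderiv ℝ (fun y => ψ y j * φ y i) x (EuclideanSpace.single j 1)
          = ψ x j * fderiv ℝ φ x (EuclideanSpace.single j 1) i
            + φ x i * fderiv ℝ (fun y => ψ y j) x (EuclideanSpace.single j 1) := by
        intro j
        rw [fderiv_fun_mul ((hψ.1.coord j).1.differentiable (by simp) x)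
          ((hφ.coord i).1.differentiable (by simp) x)]
        simp [fderiv_coord (hφ.1.differentiable (by simp) x) i]
      simp only [e, mul_add, Finset.sum_add_distrib, ← Finset.mul_sum, hψ.sum_fderiv x,
        mul_zero, add_zero, jacobian]
      rw [Finset.mul_sum]
      exact Finset.sum_congr rfl fun j _ => by ring
  rw [h1, h2, ← Finset.sum_neg_distrib]
  refine Finset.sum_congr rfl fun i _ => ?_
  rw [← Finset.sum_neg_distrib]
  refine Finset.sum_congr rfl fun j _ => ?_
  rw [hb _ (hη i j) i j, neg_neg]

theorem IsTest.memLp_top_of_ae_eq {F : Type} [NormedAddCommGroup F] [NormedSpace ℝ F]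
    {φ : Eu d → F} (hφ : IsTest Ω φ) {u : Eu d → F}
    (hu : u =ᵐ[volume.restrict Ω] φ) : MemLp u ⊤ (volume.restrict Ω) :=
  (memLp_congr_ae hu).2 (hφ.memLp ⊤)

/-- Density in `a`: since `U` and its gradient are bounded, the sum of the two forms is `inner ℝ a
h` with a fixed `h`. This `h` is orthogonal to the solenoidal test fields, hence to their closure.
-/
theorem convForm_eq_neg (hΩ : IsOpen Ω) {a : L2 Ω (Fin d)} (ha : a ∈ L2sol Ω)
    {b : L2 Ω (Fin d)} {G : L2 Ω (Fin d × Fin d)} (hb : IsWeakGrad Ω b G)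
    {U : L2 Ω (Fin d)} {φ : Eu d → Eu d} (hφ : IsTest Ω φ) (hU : U =ᵐ[volume.restrict Ω] φ) :
    convForm a G U = - convForm a (weakGrad Ω U) b := by
  have hV := (hφ.memLp_top_of_ae_eq hU).coeFn_toLp
  have hD := (hφ.jacobian.memLp_top_of_ae_eq (hφ.weakGrad_ae_eq hΩ hU).2).coeFn_toLp
  set h : L2 Ω (Fin d) := (contract d).flip.holder 2 (hφ.memLp_top_of_ae_eq hU).toLp G
    + (contract d).holder 2
      (hφ.jacobian.memLp_top_of_ae_eq (hφ.weakGrad_ae_eq hΩ hU).2).toLp b with hh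
  have key : ∀ a : L2 Ω (Fin d), convForm a G U + convForm a (weakGrad Ω U) b = inner ℝ a h := by
    intro a
    rw [hh, inner_add_right, ← convForm_eq_inner_of_bdd_right hV,
      ← convForm_eq_inner_of_bdd_mid hD]
  have horth : h ∈ (L2sol Ω)ᗮ := by
    rw [L2sol, Submodule.orthogonal_closure, Submodule.mem_orthogonal]
    intro a ha
    induction ha using Submodule.span_induction with
    | mem a ha =>
      obtain ⟨ψ, hψ, ha⟩ := ha
      rw [← key, convForm_eq_neg_of_isSolTest hΩ hψ ha hb hφ hU]
      ring
    | zero => simp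
    | add x y _ _ hx hy => rw [inner_add_left, hx, hy, add_zero]
    | smul c x _ hx => rw [real_inner_smul_left, hx, mul_zero]
  have := (Submodule.mem_orthogonal _ _).1 horth a ha
  rw [← key] at this
  linarith

/-- The derivatives `∂ⱼφᵢ` are themselves test functions for the weak gradient of `c`, so no
boundary condition on `c` enters. -/
theorem laplaceForm_eq_neg_inner (hΩ : IsOpen Ω) {U : L2 Ω (Fin d)} {φ : Eu d → Eu d}
    (hφ : IsTest Ω φ) (hU : U =ᵐ[volume.restrict Ω] φ) {c : L2 Ω (Fin d)}
    {G : L2 Ω (Fin d × Fin d)} (hc : IsWeakGrad Ω c G) :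
    laplaceForm U c = - inner ℝ G (weakGrad Ω U) := by
  have hG := (hφ.weakGrad_ae_eq hΩ hU).2
  have hG2 := (hφ.jacobian.weakGrad_ae_eq hΩ hG).2
  have hη : ∀ i j, IsTest Ω (fun x => jacobian φ x (i, j)) := fun i j => hφ.jacobian.coord (i, j)
  have hη' : ∀ i j, MemLp (fun x => fderiv ℝ (fun y => jacobian φ y (i, j)) x
      (EuclideanSpace.single j 1)) 2 (volume.restrict Ω) := fun i j =>
    ((hη i j).fderiv_apply _).memLp 2
  have h1 : laplaceForm U c = ∑ i, ∑ j, ∫ x in Ω, c x i *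
      fderiv ℝ (fun y => jacobian φ y (i, j)) x (EuclideanSpace.single j 1) := by
    rw [laplaceForm, integral_congr_ae (g := fun x => ∑ i, ∑ j, c x i *
      fderiv ℝ (fun y => jacobian φ y (i, j)) x (EuclideanSpace.single j 1)),
      integral_finsetSum]
    · refine Finset.sum_congr rfl fun i _ => ?_
      rw [integral_finsetSum]
      exact fun j _ => integrableOn_coord_mul (hη' i j) c i
    · exact fun i _ => integrable_finsetSum _ fun j _ =>
        integrableOn_coord_mul (hη' i j) c i
    · filter_upwards [hG2] with x h2
      rw [h2]
      refine Finset.sum_congr rfl fun i _ => Finset.sum_congr rfl fun j _ => ?_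
      rw [fderiv_coord (hφ.jacobian.1.differentiable (by simp) x), mul_comm]
      rfl
  have h2 : inner ℝ G (weakGrad Ω U) =
      ∑ i, ∑ j, ∫ x in Ω, G x (i, j) * jacobian φ x (i, j) := by
    rw [L2.inner_def, integral_congr_ae (g := fun x => ∑ i, ∑ j,
      G x (i, j) * jacobian φ x (i, j)), integral_finsetSum]
    · refine Finset.sum_congr rfl fun i _ => ?_
      rw [integral_finsetSum]
      exact fun j _ => integrableOn_coord_mul ((hη i j).memLp 2) G (i, j)
    · exact fun i _ => integrable_finsetSum _ fun j _ =>
        integrableOn_coord_mul ((hη i j).memLp 2) G (i, j)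
    · filter_upwards [hG] with x hx
      rw [hx, PiLp.inner_apply, Fintype.sum_prod_type]
      refine Finset.sum_congr rfl fun i _ => Finset.sum_congr rfl fun j _ => ?_
      simp [mul_comm]
  rw [h1, h2, ← Finset.sum_neg_distrib]
  refine Finset.sum_congr rfl fun i _ => ?_
  rw [← Finset.sum_neg_distrib]
  refine Finset.sum_congr rfl fun j _ => ?_
  exact hc _ (hη i j) i j

end ConvectiveForm

/-! ### Curves of smooth fields -/

section Curves

open scoped BoundedContinuousFunction

variable {d : ℕ} {Ω : Set (Eu d)}

theorem exists_boundedContinuousFunction {F : Type} [NormedAddCommGroup F]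
    {g : Eu d → F} {C : Set (Eu d)} (hC : IsCompact C) (hg : Continuous g)
    (hs : ∀ x ∉ C, g x = 0) : ∃ Γ : Eu d →ᵇ F, ⇑Γ = g := by
  obtain ⟨M, hM⟩ := hC.exists_bound_of_continuousOn hg.continuousOn
  refine ⟨BoundedContinuousFunction.ofNormedAddCommGroup g hg (max M 0) fun x => ?_, rfl⟩
  by_cases hx : x ∈ C
  · exact (hM x hx).trans (le_max_left _ _)
  · simp [hs x hx]

/-- A family of functions that is pointwise differentiable in time, with a jointly continuous
derivative and supports in a fixed compact set, is a differentiable curve in the supremum norm. -/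
theorem exists_boundedContinuousFunction_curve {F : Type} [NormedAddCommGroup F]
    [NormedSpace ℝ F] [CompleteSpace F] {g g' : ℝ → Eu d → F} {C : Set (Eu d)}
    (hC : IsCompact C) (hg : ∀ τ, Continuous (g τ)) (hs : ∀ τ, ∀ x ∉ C, g τ x = 0)
    (hs' : ∀ τ, ∀ x ∉ C, g' τ x = 0)
    (hder : ∀ τ x, HasDerivAt (fun σ => g σ x) (g' τ x) τ)
    (hc : Continuous fun p : ℝ × Eu d => g' p.1 p.2) :
    ∃ Γ Γ' : ℝ → (Eu d →ᵇ F), (∀ τ, ⇑(Γ τ) = g τ) ∧ (∀ τ, ⇑(Γ' τ) = g' τ) ∧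
      Continuous Γ' ∧ ∀ τ, HasDerivAt Γ (Γ' τ) τ := by
  choose Γ hΓ using fun τ => exists_boundedContinuousFunction hC (hg τ) (hs τ)
  choose Γ' hΓ' using fun τ => exists_boundedContinuousFunction hC
    (hc.comp (Continuous.prodMk_right τ)) (hs' τ)
  replace hΓ' : ∀ τ, ⇑(Γ' τ) = g' τ := hΓ'
  have hcont : Continuous Γ' := by
    rw [continuous_iff_continuousAt]
    intro τ
    -- Currying turns joint continuity into continuity for the compact-open topology, hence uniform
    -- closeness on `C`. Off `C` everything vanishes.
    have hcurry : Continuous (ContinuousMap.curry ⟨fun p : ℝ × Eu d => g' p.1 p.2, hc⟩) :=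
      ContinuousMap.continuous _
    have hunif := ContinuousMap.tendsto_iff_forall_isCompact_tendstoUniformlyOn.1
      (hcurry.tendsto τ) C hC
    rw [Metric.tendstoUniformlyOn_iff] at hunif
    rw [ContinuousAt, Metric.tendsto_nhds]
    intro ε hε
    filter_upwards [hunif (ε / 2) (half_pos hε)] with σ hσ
    refine lt_of_le_of_lt ((BoundedContinuousFunction.dist_le (half_pos hε).le).2 fun x => ?_)
      (half_lt_self hε)
    rw [hΓ', hΓ']
    by_cases hx : x ∈ C
    · rw [dist_comm]
      exact (hσ x hx).le
    · rw [hs' σ x hx, hs' τ x hx, dist_self]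
      exact (half_pos hε).le
  -- Point evaluation commutes with the integral, so the scalar fundamental theorem identifies `Γ`
  -- as a primitive of the continuous `Γ'`. Differentiability in the supremum norm follows.
  have hintegral : ∀ τ, Γ τ = Γ 0 + ∫ σ in (0 : ℝ)..τ, Γ' σ := by
    intro τ
    ext x
    have h1 : (∫ σ in (0 : ℝ)..τ, Γ' σ) x = ∫ σ in (0 : ℝ)..τ, Γ' σ x :=
      ((BoundedContinuousFunction.evalCLM ℝ x).intervalIntegral_comp_comm
        (hcont.intervalIntegrable 0 τ)).symm
    have h2 : ∫ σ in (0 : ℝ)..τ, Γ' σ x = g τ x - g 0 x := by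
      simp only [hΓ']
      refine intervalIntegral.integral_eq_sub_of_hasDerivAt (fun σ _ => hder σ x) ?_
      exact (hc.comp (Continuous.prodMk_left x)).intervalIntegrable 0 τ
    rw [BoundedContinuousFunction.add_apply, h1, h2, hΓ, hΓ]
    abel
  refine ⟨Γ, Γ', hΓ, hΓ', hcont, fun τ => ?_⟩
  have := (intervalIntegral.integral_hasDerivAt_right (hcont.intervalIntegrable 0 τ)
    (hcont.stronglyMeasurableAtFilter _ _) hcont.continuousAt).const_add (Γ 0)
  exact this.congr_of_eventuallyEq (.of_forall hintegral)

theorem memLp_timeMeasure_of_continuous {E : Type*} [NormedAddCommGroup E] {g : ℝ → E}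
    (hg : Continuous g) (T : ℝ) (p : ℝ≥0∞) : MemLp g p (timeMeasure T) := by
  obtain ⟨M, hM⟩ := (isCompact_Icc (a := (0 : ℝ)) (b := T)).exists_bound_of_continuousOn
    hg.continuousOn
  refine MemLp.of_bound hg.aestronglyMeasurable M ?_
  filter_upwards [ae_restrict_mem measurableSet_Ioo] with τ hτ
  exact hM τ (Ioo_subset_Icc_self hτ)

theorem toL2_ae_eq {φ : Eu d → Eu d} (hφ : IsTest Ω φ) :
    toL2 Ω φ =ᵐ[volume.restrict Ω] φ := by
  rw [toL2, dif_pos (hφ.memLp 2)]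
  exact (hφ.memLp 2).coeFn_toLp

theorem toL2_mem_L2sol {φ : Eu d → Eu d} (hφ : IsSolTest Ω φ) : toL2 Ω φ ∈ L2sol Ω :=
  Submodule.le_topologicalClosure _ (Submodule.subset_span ⟨φ, hφ, toL2_ae_eq hφ.1⟩)

theorem IsSolTest.mem_H10sol (hΩ : IsOpen Ω) {φ : Eu d → Eu d} (hφ : IsSolTest Ω φ) :
    (toL2 Ω φ, weakGrad Ω (toL2 Ω φ)) ∈ H10sol Ω :=
  Submodule.le_topologicalClosure _ (Submodule.subset_span
    ⟨φ, hφ, toL2_ae_eq hφ.1, (hφ.1.weakGrad_ae_eq hΩ (toL2_ae_eq hφ.1)).2⟩)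

theorem toL2_smul (c : ℝ) {φ : Eu d → Eu d} (hφ : IsTest Ω φ) :
    toL2 Ω (fun x => c • φ x) = c • toL2 Ω φ := by
  have h : MemLp (fun x => c • φ x) 2 (volume.restrict Ω) := (hφ.memLp 2).const_smul c
  rw [toL2, toL2, dif_pos (hφ.memLp 2), dif_pos h]
  exact MemLp.toLp_const_smul c (hφ.memLp 2)

/-- `IsC1Sol` speaks of `iteratedFDeriv`. Second gradients are rewritten in that form to inherit
their time regularity. -/
theorem jacobian_jacobian_apply {φ : Eu d → Eu d} (hφ : ContDiff ℝ ∞ φ) (x : Eu d)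
    (p : (Fin d × Fin d) × Fin d) :
    jacobian (jacobian φ) x p = iteratedFDeriv ℝ 2 φ x
      ![EuclideanSpace.single p.2 1, EuclideanSpace.single p.1.2 1] p.1.1 := by
  have h1 : ContDiff ℝ ∞ (fderiv ℝ φ) := hφ.fderiv_right (by simp)
  have h2 : ContDiff ℝ ∞ (fun y => fderiv ℝ φ y (EuclideanSpace.single p.1.2 1)) :=
    h1.clm_apply contDiff_const
  have h3 : DifferentiableAt ℝ (jacobian φ) x := by
    have : ContDiff ℝ ∞ (jacobian φ) := by
      rw [contDiff_euclidean]
      intro q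
      exact (EuclideanSpace.proj (𝕜 := ℝ) q.1).contDiff.comp
        (h1.clm_apply (contDiff_const (c := EuclideanSpace.single q.2 1)))
    exact this.differentiable (by simp) x
  rw [iteratedFDeriv_two_apply]
  change fderiv ℝ (jacobian φ) x (EuclideanSpace.single p.2 1) p.1 = _
  rw [← fderiv_coord h3]
  change fderiv ℝ (fun y => fderiv ℝ φ y (EuclideanSpace.single p.1.2 1) p.1.1) x _ = _
  rw [fderiv_coord (h2.differentiable (by simp) x)]
  rw [fderiv_clm_apply (h1.differentiable (by simp) x) (differentiableAt_const _)]
  simp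

theorem jacobian_eq_iteratedFDeriv (φ : Eu d → Eu d) (x : Eu d) (p : Fin d × Fin d) :
    jacobian φ x p = iteratedFDeriv ℝ 1 φ x (fun _ => EuclideanSpace.single p.2 1) p.1 := by
  rw [iteratedFDeriv_one_apply]
  rfl

theorem hasDerivAt_euclidean {ι : Type} [Fintype ι] {g : ℝ → EuclideanSpace ℝ ι}
    {g' : EuclideanSpace ℝ ι} {τ : ℝ} (h : ∀ i, HasDerivAt (fun σ => g σ i) (g' i) τ) :
    HasDerivAt g g' τ := by
  have h1 : HasDerivAt (fun σ => (g σ).ofLp) g'.ofLp τ := hasDerivAt_pi.2 h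
  exact (EuclideanSpace.equiv ι ℝ).symm.toContinuousLinearMap.hasFDerivAt.comp_hasDerivAt τ h1

theorem iteratedFDeriv_fun_const_smul {g : Eu d → Eu d} (hg : ContDiff ℝ ∞ g) (c : ℝ) (n : ℕ)
    (x : Eu d) :
    iteratedFDeriv ℝ n (fun y => c • g y) x = c • iteratedFDeriv ℝ n g x := by
  have h : ContDiff ℝ n g := hg.of_le (by exact_mod_cast le_top)
  change iteratedFDeriv ℝ n (c • g) x = _
  exact iteratedFDeriv_const_smul_apply h.contDiffAt

instance completeSpace_L2sol : CompleteSpace (L2sol Ω) :=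
  (Submodule.isClosed_topologicalClosure _).completeSpace_coe

namespace IsC1Sol

variable {φ : ℝ → Eu d → Eu d}

theorem exists_isTest (hφ : IsC1Sol Ω φ) : ∃ C, IsCompact C ∧ C ⊆ Ω ∧
    (∀ τ, IsTest C (φ τ)) ∧ ∀ τ, IsTest C (timeDeriv φ τ) := by
  obtain ⟨C, hC, hCΩ, hs⟩ := hφ.support
  have hs' : ∀ τ, ∀ x ∉ C, timeDeriv φ τ x = 0 := by
    intro τ x hx
    simp [timeDeriv, hs _ x hx]
  have aux : ∀ g : Eu d → Eu d, ContDiff ℝ ∞ g → (∀ x ∉ C, g x = 0) → IsTest C g := by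
    intro g hg h0
    have : tsupport g ⊆ C := closure_minimal
      (fun x hx => by_contra fun hxC => hx (h0 x hxC)) hC.isClosed
    exact ⟨hg, hC.of_isClosed_subset (isClosed_tsupport g) this, this⟩
  exact ⟨C, hC, hCΩ, fun τ => aux _ (hφ.smooth τ) (hs τ),
    fun τ => aux _ (hφ.smooth_timeDeriv τ) (hs' τ)⟩

theorem isSolTest (hφ : IsC1Sol Ω φ) (τ : ℝ) : IsSolTest Ω (φ τ) := by
  obtain ⟨C, -, hCΩ, h, -⟩ := hφ.exists_isTest
  exact ⟨⟨(h τ).1, (h τ).2.1, (h τ).2.2.trans hCΩ⟩, hφ.solenoidal τ⟩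

theorem hasDerivAt_jacobian (hφ : IsC1Sol Ω φ) (τ : ℝ) (x : Eu d) :
    HasDerivAt (fun σ => jacobian (φ σ) x) (jacobian (timeDeriv φ τ) x) τ := by
  refine hasDerivAt_euclidean fun p => ?_
  simp only [jacobian_eq_iteratedFDeriv]
  exact ((EuclideanSpace.proj (𝕜 := ℝ) p.1).comp (ContinuousMultilinearMap.apply ℝ
    (fun _ : Fin 1 => Eu d) (Eu d) fun _ => EuclideanSpace.single p.2 1)).hasFDerivAt.comp_hasDerivAt
      τ (hφ.hasDerivAt 1 τ x)

theorem hasDerivAt_jacobian_jacobian (hφ : IsC1Sol Ω φ) (τ : ℝ) (x : Eu d) :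
    HasDerivAt (fun σ => jacobian (jacobian (φ σ)) x) (jacobian (jacobian (timeDeriv φ τ)) x) τ := by
  refine hasDerivAt_euclidean fun p => ?_
  simp only [jacobian_jacobian_apply (hφ.smooth _), jacobian_jacobian_apply (hφ.smooth_timeDeriv _)]
  exact ((EuclideanSpace.proj (𝕜 := ℝ) p.1.1).comp (ContinuousMultilinearMap.apply ℝ
    (fun _ : Fin 2 => Eu d) (Eu d) ![EuclideanSpace.single p.2 1,
      EuclideanSpace.single p.1.2 1])).hasFDerivAt.comp_hasDerivAt τ (hφ.hasDerivAt 2 τ x)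

theorem hasDerivAt_apply (hφ : IsC1Sol Ω φ) (τ : ℝ) (x : Eu d) :
    HasDerivAt (fun σ => φ σ x) (timeDeriv φ τ x) τ := by
  have := (ContinuousMultilinearMap.apply ℝ (fun _ : Fin 0 => Eu d) (Eu d)
    ![]).hasFDerivAt.comp_hasDerivAt τ (hφ.hasDerivAt 0 τ x)
  simpa [Function.comp_def] using this

theorem continuous_timeDeriv (hφ : IsC1Sol Ω φ) :
    Continuous fun p : ℝ × Eu d => timeDeriv φ p.1 p.2 := by
  simpa [Function.comp_def] using (ContinuousMultilinearMap.apply ℝ (fun _ : Fin 0 => Eu d) (Eu d)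
    ![]).continuous.comp (hφ.continuous 0)

theorem continuous_jacobian_timeDeriv (hφ : IsC1Sol Ω φ) :
    Continuous fun p : ℝ × Eu d => jacobian (timeDeriv φ p.1) p.2 := by
  refine (PiLp.continuous_toLp 2 _).comp (continuous_pi fun q => ?_)
  have := ((EuclideanSpace.proj (𝕜 := ℝ) q.1).comp (ContinuousMultilinearMap.apply ℝ
    (fun _ : Fin 1 => Eu d) (Eu d) fun _ => EuclideanSpace.single q.2 1)).continuous.comp
      (hφ.continuous 1)
  exact this.congr fun p => (jacobian_eq_iteratedFDeriv _ _ q).symm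

theorem continuous_jacobian_jacobian_timeDeriv (hφ : IsC1Sol Ω φ) :
    Continuous fun p : ℝ × Eu d => jacobian (jacobian (timeDeriv φ p.1)) p.2 := by
  refine (PiLp.continuous_toLp 2 _).comp (continuous_pi fun q => ?_)
  have := ((EuclideanSpace.proj (𝕜 := ℝ) q.1.1).comp (ContinuousMultilinearMap.apply ℝ
    (fun _ : Fin 2 => Eu d) (Eu d) ![EuclideanSpace.single q.2 1,
      EuclideanSpace.single q.1.2 1])).continuous.comp (hφ.continuous 2)
  exact this.congr fun p => (jacobian_jacobian_apply (hφ.smooth_timeDeriv _) _ q).symm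

/-- The divergence commutes with the time derivative, and the divergence of `φ` is constantly zero.
-/
theorem isSolTest_timeDeriv (hφ : IsC1Sol Ω φ) (τ : ℝ) : IsSolTest Ω (timeDeriv φ τ) := by
  obtain ⟨C, -, hCΩ, -, h⟩ := hφ.exists_isTest
  refine ⟨⟨(h τ).1, (h τ).2.1, (h τ).2.2.trans hCΩ⟩, fun x => ?_⟩
  have h1 : HasDerivAt (fun σ => diverg (φ σ) x) (diverg (timeDeriv φ τ) x) τ := by
    unfold diverg
    refine HasDerivAt.fun_sum fun i _ => ?_
    exact (EuclideanSpace.proj (𝕜 := ℝ) (i, i)).hasFDerivAt.comp_hasDerivAt τ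
      (hφ.hasDerivAt_jacobian τ x)
  simp only [hφ.solenoidal] at h1
  exact h1.unique (hasDerivAt_const τ 0)

theorem const_smul (hφ : IsC1Sol Ω φ) (c : ℝ) : IsC1Sol Ω (fun τ x => c • φ τ x) := by
  have ht : timeDeriv (fun τ x => c • φ τ x) = fun τ x => c • timeDeriv φ τ x := by
    ext1 τ
    ext1 x
    exact ((hφ.hasDerivAt_apply τ x).const_smul c).deriv
  obtain ⟨C, hC, hCΩ, hs⟩ := hφ.support
  refine ⟨⟨C, hC, hCΩ, fun τ x hx => by simp [hs τ x hx]⟩,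
    fun τ => (hφ.smooth τ).const_smul c, fun τ x => ?_, fun τ => ?_, fun n τ x => ?_, fun n => ?_⟩
  · have : diverg (fun x => c • φ τ x) x = c * diverg (φ τ) x := by
      unfold diverg grad
      rw [Finset.mul_sum]
      refine Finset.sum_congr rfl fun i _ => ?_
      have := fderiv_fun_const_smul ((hφ.smooth τ).differentiable (by simp) x) c
      simp [this]
    rw [this, hφ.solenoidal, mul_zero]
  · rw [ht]
    exact (hφ.smooth_timeDeriv τ).const_smul c
  · rw [ht]
    simp only [iteratedFDeriv_fun_const_smul (hφ.smooth _),
      iteratedFDeriv_fun_const_smul (hφ.smooth_timeDeriv _)]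
    exact (hφ.hasDerivAt n τ x).const_smul c
  · rw [ht]
    simp only [iteratedFDeriv_fun_const_smul (hφ.smooth_timeDeriv _)]
    exact (hφ.continuous n).const_smul c

/-- The curve in `L²_σ` given by a family of smooth fields. -/
def curve (hφ : IsC1Sol Ω φ) (τ : ℝ) : L2sol Ω := ⟨toL2 Ω (φ τ), toL2_mem_L2sol (hφ.isSolTest τ)⟩

/-- The time derivative of `IsC1Sol.curve`. -/
def velocity (hφ : IsC1Sol Ω φ) (τ : ℝ) : L2sol Ω :=
  ⟨toL2 Ω (timeDeriv φ τ), toL2_mem_L2sol (hφ.isSolTest_timeDeriv τ)⟩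

theorem curve_ae_eq (hφ : IsC1Sol Ω φ) (τ : ℝ) :
    (hφ.curve τ : L2 Ω (Fin d)) =ᵐ[volume.restrict Ω] φ τ :=
  toL2_ae_eq (hφ.isSolTest τ).1

theorem velocity_ae_eq (hφ : IsC1Sol Ω φ) (τ : ℝ) :
    (hφ.velocity τ : L2 Ω (Fin d)) =ᵐ[volume.restrict Ω] timeDeriv φ τ :=
  toL2_ae_eq (hφ.isSolTest_timeDeriv τ).1

theorem isWeakGrad_curve (hΩ : IsOpen Ω) (hφ : IsC1Sol Ω φ) (τ : ℝ) :
    IsWeakGrad Ω (hφ.curve τ : L2 Ω (Fin d)) (weakGrad Ω (hφ.curve τ : L2 Ω (Fin d))) :=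
  ((hφ.isSolTest τ).1.weakGrad_ae_eq hΩ (hφ.curve_ae_eq τ)).1

theorem weakGrad_curve_ae_eq (hΩ : IsOpen Ω) (hφ : IsC1Sol Ω φ) (τ : ℝ) :
    weakGrad Ω (hφ.curve τ : L2 Ω (Fin d)) =ᵐ[volume.restrict Ω] jacobian (φ τ) :=
  ((hφ.isSolTest τ).1.weakGrad_ae_eq hΩ (hφ.curve_ae_eq τ)).2

theorem exists_boundedContinuousFunction_curve (hφ : IsC1Sol Ω φ) :
    ∃ Γ Γ' : ℝ → (Eu d →ᵇ Eu d), (∀ τ, ⇑(Γ τ) = φ τ) ∧ (∀ τ, ⇑(Γ' τ) = timeDeriv φ τ) ∧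
      Continuous Γ' ∧ ∀ τ, HasDerivAt Γ (Γ' τ) τ := by
  obtain ⟨C, hC, hCΩ, h, h'⟩ := hφ.exists_isTest
  exact EnergyVariational.exists_boundedContinuousFunction_curve hC
    (fun τ => (h τ).1.continuous)
    (fun τ x hx => image_eq_zero_of_notMem_tsupport fun hx' => hx ((h τ).2.2 hx'))
    (fun τ x hx => image_eq_zero_of_notMem_tsupport fun hx' => hx ((h' τ).2.2 hx'))
    hφ.hasDerivAt_apply hφ.continuous_timeDeriv

theorem exists_boundedContinuousFunction_jacobian (hφ : IsC1Sol Ω φ) :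
    ∃ Γ : ℝ → (Eu d →ᵇ EuclideanSpace ℝ (Fin d × Fin d)),
      (∀ τ, ⇑(Γ τ) = jacobian (φ τ)) ∧ Continuous Γ := by
  obtain ⟨C, hC, hCΩ, h, h'⟩ := hφ.exists_isTest
  obtain ⟨Γ, Γ', h1, -, -, h2⟩ := EnergyVariational.exists_boundedContinuousFunction_curve hC
    (fun τ => (h τ).jacobian.1.continuous)
    (fun τ x hx => image_eq_zero_of_notMem_tsupport fun hx' => hx ((h τ).jacobian.2.2 hx'))
    (fun τ x hx => image_eq_zero_of_notMem_tsupport fun hx' => hx ((h' τ).jacobian.2.2 hx'))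
    hφ.hasDerivAt_jacobian hφ.continuous_jacobian_timeDeriv
  exact ⟨Γ, h1, continuous_iff_continuousAt.2 fun τ => (h2 τ).continuousAt⟩

theorem exists_boundedContinuousFunction_jacobian_jacobian (hφ : IsC1Sol Ω φ) :
    ∃ Γ : ℝ → (Eu d →ᵇ EuclideanSpace ℝ ((Fin d × Fin d) × Fin d)),
      (∀ τ, ⇑(Γ τ) = jacobian (jacobian (φ τ))) ∧ Continuous Γ := by
  obtain ⟨C, hC, hCΩ, h, h'⟩ := hφ.exists_isTest
  obtain ⟨Γ, Γ', h1, -, -, h2⟩ := EnergyVariational.exists_boundedContinuousFunction_curve hC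
    (fun τ => (h τ).jacobian.jacobian.1.continuous)
    (fun τ x hx => image_eq_zero_of_notMem_tsupport fun hx' => hx ((h τ).jacobian.jacobian.2.2 hx'))
    (fun τ x hx => image_eq_zero_of_notMem_tsupport
      fun hx' => hx ((h' τ).jacobian.jacobian.2.2 hx'))
    hφ.hasDerivAt_jacobian_jacobian hφ.continuous_jacobian_jacobian_timeDeriv
  exact ⟨Γ, h1, continuous_iff_continuousAt.2 fun τ => (h2 τ).continuousAt⟩

variable [IsFiniteMeasure (volume.restrict Ω)]

theorem hasDerivAt_curve_and_continuous_velocity (hφ : IsC1Sol Ω φ) :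
    (∀ τ, HasDerivAt hφ.curve (hφ.velocity τ) τ) ∧ Continuous hφ.velocity := by
  obtain ⟨Γ, Γ', h1, h2, h3, h4⟩ := hφ.exists_boundedContinuousFunction_curve
  set A := BoundedContinuousFunction.toLp (E := Eu d) 2 (volume.restrict Ω) ℝ
  have e1 : ∀ τ, (hφ.curve τ : L2 Ω (Fin d)) = A (Γ τ) := fun τ => Lp.ext
    ((hφ.curve_ae_eq τ).trans (h1 τ ▸
      (BoundedContinuousFunction.coeFn_toLp 2 (volume.restrict Ω) ℝ (Γ τ)).symm))
  have e2 : ∀ τ, (hφ.velocity τ : L2 Ω (Fin d)) = A (Γ' τ) := fun τ => Lp.ext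
    ((hφ.velocity_ae_eq τ).trans (h2 τ ▸
      (BoundedContinuousFunction.coeFn_toLp 2 (volume.restrict Ω) ℝ (Γ' τ)).symm))
  refine ⟨fun τ => ?_, ?_⟩
  · have h5 : HasDerivAt (fun σ => (hφ.curve σ : L2 Ω (Fin d))) (hφ.velocity τ) τ := by
      simp only [e1, e2]
      exact A.hasFDerivAt.comp_hasDerivAt τ (h4 τ)
    -- The slopes lie in the subspace, so their convergence in `L²` is convergence in `L²_σ`.
    rw [hasDerivAt_iff_tendsto_slope] at h5 ⊢
    rw [tendsto_subtype_rng]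
    exact h5
  · rw [continuous_induced_rng]
    exact (A.continuous.comp h3).congr fun τ => (e2 τ).symm

theorem hasDerivAt_curve (hφ : IsC1Sol Ω φ) (τ : ℝ) :
    HasDerivAt hφ.curve (hφ.velocity τ) τ :=
  hφ.hasDerivAt_curve_and_continuous_velocity.1 τ

theorem continuous_velocity (hφ : IsC1Sol Ω φ) : Continuous hφ.velocity :=
  hφ.hasDerivAt_curve_and_continuous_velocity.2

theorem continuous_curve (hφ : IsC1Sol Ω φ) : Continuous hφ.curve :=
  continuous_iff_continuousAt.2 fun τ => (hφ.hasDerivAt_curve τ).continuousAt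

theorem exists_continuous_Lp_top_curve (hφ : IsC1Sol Ω φ) :
    ∃ V : ℝ → Lp (Eu d) ⊤ (volume.restrict Ω), Continuous V ∧
      ∀ τ, V τ =ᵐ[volume.restrict Ω] (hφ.curve τ : L2 Ω (Fin d)) := by
  obtain ⟨Γ, Γ', h1, h2, h3, h4⟩ := hφ.exists_boundedContinuousFunction_curve
  refine ⟨fun τ => BoundedContinuousFunction.toLp ⊤ (volume.restrict Ω) ℝ (Γ τ),
    (ContinuousLinearMap.continuous _).comp
      (continuous_iff_continuousAt.2 fun τ => (h4 τ).continuousAt), fun τ => ?_⟩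
  refine (BoundedContinuousFunction.coeFn_toLp _ _ _ _).trans ?_
  rw [h1]
  exact (hφ.curve_ae_eq τ).symm

theorem exists_continuous_Lp_top_weakGrad (hΩ : IsOpen Ω) (hφ : IsC1Sol Ω φ) :
    ∃ D : ℝ → Lp (EuclideanSpace ℝ (Fin d × Fin d)) ⊤ (volume.restrict Ω), Continuous D ∧
      ∀ τ, D τ =ᵐ[volume.restrict Ω] weakGrad Ω (hφ.curve τ : L2 Ω (Fin d)) := by
  obtain ⟨Γ, h1, h2⟩ := hφ.exists_boundedContinuousFunction_jacobian
  refine ⟨fun τ => BoundedContinuousFunction.toLp ⊤ (volume.restrict Ω) ℝ (Γ τ),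
    (ContinuousLinearMap.continuous _).comp h2, fun τ => ?_⟩
  refine (BoundedContinuousFunction.coeFn_toLp _ _ _ _).trans ?_
  rw [h1]
  exact (hφ.weakGrad_curve_ae_eq hΩ τ).symm

theorem continuous_weakGrad (hΩ : IsOpen Ω) (hφ : IsC1Sol Ω φ) :
    Continuous fun τ => weakGrad Ω (hφ.curve τ : L2 Ω (Fin d)) := by
  obtain ⟨Γ, h1, h2⟩ := hφ.exists_boundedContinuousFunction_jacobian
  refine ((ContinuousLinearMap.continuous
    (BoundedContinuousFunction.toLp 2 (volume.restrict Ω) ℝ)).comp h2).congr fun τ => Lp.ext ?_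
  refine (BoundedContinuousFunction.coeFn_toLp _ _ _ _).trans ?_
  rw [h1]
  exact (hφ.weakGrad_curve_ae_eq hΩ τ).symm

theorem continuous_weakGrad_weakGrad (hΩ : IsOpen Ω) (hφ : IsC1Sol Ω φ) :
    Continuous fun τ => weakGrad Ω (weakGrad Ω (hφ.curve τ : L2 Ω (Fin d))) := by
  obtain ⟨Γ, h1, h2⟩ := hφ.exists_boundedContinuousFunction_jacobian_jacobian
  refine ((ContinuousLinearMap.continuous
    (BoundedContinuousFunction.toLp 2 (volume.restrict Ω) ℝ)).comp h2).congr fun τ => Lp.ext ?_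
  refine (BoundedContinuousFunction.coeFn_toLp _ _ _ _).trans ?_
  rw [h1]
  exact ((hφ.isSolTest τ).1.jacobian.weakGrad_ae_eq hΩ (hφ.weakGrad_curve_ae_eq hΩ τ)).2.symm

theorem memX_curve (hΩ : IsOpen Ω) (hφ : IsC1Sol Ω φ) (T ν : ℝ) : MemX Ω T ν hφ.curve where
  bounded := memLp_timeMeasure_of_continuous hφ.continuous_curve T ⊤
  mem_H10sol _ := .of_forall fun τ => (hφ.isSolTest τ).mem_H10sol hΩ
  grad_memLp _ := memLp_timeMeasure_of_continuous (hφ.continuous_weakGrad hΩ) T 2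

theorem memY_curve (hΩ : IsOpen Ω) (hφ : IsC1Sol Ω φ) (T ν : ℝ) :
    MemY Ω T ν hφ.curve hφ.velocity where
  memX := hφ.memX_curve hΩ T ν
  hasWeakGrad := .of_forall fun τ => hφ.isWeakGrad_curve hΩ τ
  hasWeakGrad_two _ := .of_forall fun τ =>
    ((hφ.isSolTest τ).1.jacobian.weakGrad_ae_eq hΩ (hφ.weakGrad_curve_ae_eq hΩ τ)).1
  memLp_two _ := memLp_timeMeasure_of_continuous (hφ.continuous_weakGrad_weakGrad hΩ) T 2
  lipschitz := by
    obtain ⟨V, hV, hV'⟩ := hφ.exists_continuous_Lp_top_curve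
    obtain ⟨D, hD, hD'⟩ := hφ.exists_continuous_Lp_top_weakGrad hΩ
    exact ⟨V, D, memLp_timeMeasure_of_continuous hV T 1, memLp_timeMeasure_of_continuous hD T 1,
      .of_forall fun τ => ⟨hV' τ, hD' τ⟩⟩
  timeDeriv_memLp := memLp_timeMeasure_of_continuous hφ.continuous_velocity T 2
  hasTimeDeriv t _ := by
    rw [intervalIntegral.integral_eq_sub_of_hasDerivAt (fun τ _ => hφ.hasDerivAt_curve τ)
      (hφ.continuous_velocity.intervalIntegrable 0 t)]
    abel

end IsC1Sol

end Curves

/-! ### An admissible regularity measure -/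

section RegularityMeasure

/-- A functional homogeneous of degree `m` takes the value `A |p(τ)|^m` along the curve `p(τ) • U`.
To match `g`, it is approximated in `L¹` by a continuous `k`, and Weierstrass approximation is
applied to the `m`-th root of `max k 0 / A`. Polynomials keep the curve `C¹` in time. -/
theorem exists_polynomial_integral_abs_pow_sub_lt {T A : ℝ} (hA : 0 < A) {m : ℕ} (hm : m ≠ 0)
    {g : ℝ → ℝ} (hg : Integrable g (timeMeasure T)) (hg0 : ∀ τ, 0 ≤ g τ) {ε : ℝ} (hε : 0 < ε) :
    ∃ p : Polynomial ℝ, ∫ τ, |A * |p.eval τ| ^ m - g τ| ∂(timeMeasure T) < ε := by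
  obtain ⟨k, hk, hki⟩ := hg.exists_boundedContinuous_integral_sub_le (half_pos hε)
  set θ : ℝ → ℝ := fun τ => (max (k τ) 0 / A) ^ ((m : ℝ)⁻¹) with hθ
  have hθc : Continuous θ := by
    refine Continuous.rpow_const (by fun_prop) fun τ => Or.inr (by positivity)
  have hθ0 : ∀ τ, 0 ≤ θ τ := fun τ => by positivity
  have hθm : ∀ τ, A * θ τ ^ m = max (k τ) 0 := by
    intro τ
    rw [hθ]
    simp only
    rw [Real.rpow_inv_natCast_pow (by positivity) hm]
    field_simp
  obtain ⟨M, hM⟩ := (isCompact_Icc (a := (0 : ℝ)) (b := T)).exists_bound_of_continuousOn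
    hθc.continuousOn
  -- A Lipschitz constant of `x ↦ A x^m` on `[0, |M| + 1]`. The choice of `δ` below keeps the
  -- approximant in this range and its integrated error under `ε / 4`.
  set B : ℝ := A * (m * (|M| + 1) ^ (m - 1)) with hB
  have hB0 : 0 ≤ B := by positivity
  set δ : ℝ := min 1 (ε / (4 * (B + 1) * (|T| + 1))) with hδ
  have hδ0 : 0 < δ := lt_min one_pos (by positivity)
  obtain ⟨p, hp⟩ := exists_polynomial_near_of_continuousOn 0 T θ hθc.continuousOn δ hδ0
  refine ⟨p, ?_⟩
  have hpc : Continuous fun τ => A * |p.eval τ| ^ m := by fun_prop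
  have hpi : Integrable (fun τ => A * |p.eval τ| ^ m) (timeMeasure T) :=
    memLp_one_iff_integrable.1 (memLp_timeMeasure_of_continuous hpc T 1)
  have hpt : ∀ τ ∈ Ioo 0 T, |A * |p.eval τ| ^ m - g τ| ≤ B * δ + ‖g τ - k τ‖ := by
    intro τ hτ
    have hτ' := Ioo_subset_Icc_self hτ
    have h1 := hp τ hτ'
    have h2 : θ τ ≤ |M| := by
      have := hM τ hτ'
      rw [Real.norm_of_nonneg (hθ0 τ)] at this
      exact this.trans (le_abs_self M)
    have h3 : |(|p.eval τ| - θ τ)| ≤ δ := by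
      have := abs_abs_sub_abs_le_abs_sub (p.eval τ) (θ τ)
      rw [abs_of_nonneg (hθ0 τ)] at this
      exact this.trans h1.le
    have h4 : |p.eval τ| ≤ |M| + 1 := by
      have := (abs_le.1 h3).2
      have := min_le_left 1 (ε / (4 * (B + 1) * (|T| + 1)))
      linarith
    have h5 : |(|p.eval τ| ^ m - θ τ ^ m)| ≤ δ * (m * (|M| + 1) ^ (m - 1)) := by
      refine (abs_pow_sub_pow_le _ _ m).trans ?_
      rw [abs_abs, abs_of_nonneg (hθ0 τ), mul_assoc]
      gcongr
      exact max_le h4 (by linarith)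
    have h6 : |max (k τ) 0 - g τ| ≤ ‖g τ - k τ‖ := by
      rw [Real.norm_eq_abs, abs_sub_comm (g τ)]
      have := abs_max_sub_max_le_abs (k τ) (g τ) 0
      rwa [max_eq_left (hg0 τ)] at this
    calc |A * |p.eval τ| ^ m - g τ|
        ≤ |A * |p.eval τ| ^ m - A * θ τ ^ m| + |A * θ τ ^ m - g τ| := abs_sub_le _ _ _
      _ = A * |(|p.eval τ| ^ m - θ τ ^ m)| + |max (k τ) 0 - g τ| := by
          rw [← mul_sub, abs_mul, abs_of_pos hA, hθm]
      _ ≤ A * (δ * (m * (|M| + 1) ^ (m - 1))) + ‖g τ - k τ‖ := by gcongr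
      _ = B * δ + ‖g τ - k τ‖ := by rw [hB]; ring
  have hle : ∫ τ, |A * |p.eval τ| ^ m - g τ| ∂(timeMeasure T)
      ≤ ∫ τ, (B * δ + ‖g τ - k τ‖) ∂(timeMeasure T) := by
    refine integral_mono_ae (hpi.sub hg).abs ((integrable_const _).add (hg.sub hki).norm) ?_
    filter_upwards [ae_restrict_mem measurableSet_Ioo] with τ hτ using hpt τ hτ
  rw [integral_add (g := fun τ => ‖g τ - k τ‖) (integrable_const _) (hg.sub hki).norm] at hle
  have hvol : ∫ _, B * δ ∂(timeMeasure T) ≤ ε / 4 := by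
    rw [setIntegral_const, smul_eq_mul, Real.volume_real_Ioo]
    have h1 : max (T - 0) 0 ≤ |T| + 1 := max_le (by linarith [le_abs_self T]) (by positivity)
    calc max (T - 0) 0 * (B * δ)
        ≤ (|T| + 1) * ((B + 1) * (ε / (4 * (B + 1) * (|T| + 1)))) := by
          gcongr
          · linarith
          · exact min_le_right _ _
      _ = ε / 4 := by field_simp
  linarith

variable {d : ℕ} {Ω : Set (Eu d)}

/-- The `W^{1,∞}`-norm of a field in `L²_σ`. -/
def lipNorm (u : L2sol Ω) : ℝ≥0∞ :=
  eLpNorm (u : L2 Ω (Fin d)) ⊤ (volume.restrict Ω)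
    + eLpNorm (weakGrad Ω (u : L2 Ω (Fin d))) ⊤ (volume.restrict Ω)

/-- The constant in `regMeasure`. -/
def regConst (d : ℕ) (ν : ℝ) : ℝ :=
  if ν = 0 then 2 * ‖contract d‖ + 1 else ‖contract d‖ ^ 2 / (2 * ν) + 1

/-- The homogeneity degree of `regMeasure`. -/
def regDegree (ν : ℝ) : ℕ := if ν = 0 then 1 else 2

/-- A regularity measure: a multiple of the `W^{1,∞}`-norm for `ν = 0`, and of its square
for `ν > 0`. -/
def regMeasure (Ω : Set (Eu d)) (ν : ℝ) (u : L2sol Ω) : ℝ≥0∞ :=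
  ENNReal.ofReal (regConst d ν) * lipNorm u ^ regDegree ν

theorem regConst_pos {ν : ℝ} (hν : 0 ≤ ν) : 0 < regConst d ν := by
  unfold regConst
  split_ifs <;> positivity

theorem regDegree_ne_zero (ν : ℝ) : regDegree ν ≠ 0 := by
  unfold regDegree
  split_ifs <;> norm_num

theorem lipNorm_smul (hΩ : IsOpen Ω) (c : ℝ) (u : L2sol Ω) :
    lipNorm (c • u) = ‖c‖ₑ * lipNorm u := by
  unfold lipNorm
  rw [Submodule.coe_smul, weakGrad_const_smul hΩ, mul_add,
    eLpNorm_congr_ae (Lp.coeFn_smul c (u : L2 Ω (Fin d))), eLpNorm_const_smul,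
    eLpNorm_congr_ae (Lp.coeFn_smul c (weakGrad Ω (u : L2 Ω (Fin d)))), eLpNorm_const_smul]

theorem regMeasure_zero (hΩ : IsOpen Ω) (ν : ℝ) : regMeasure Ω ν 0 = 0 := by
  have := lipNorm_smul hΩ 0 (0 : L2sol Ω)
  simp only [zero_smul, enorm_zero, zero_mul] at this
  simp [regMeasure, this, regDegree_ne_zero]

theorem MemX.congr_ae {T ν : ℝ} {u u' : ℝ → L2sol Ω} (hu : MemX Ω T ν u)
    (h : u =ᵐ[timeMeasure T] u') : MemX Ω T ν u' where
  bounded := (memLp_congr_ae h).1 hu.bounded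
  mem_H10sol hν := by
    filter_upwards [hu.mem_H10sol hν, h] with τ h1 h2
    rwa [← h2]
  grad_memLp hν := by
    refine (memLp_congr_ae ?_).1 (hu.grad_memLp hν)
    filter_upwards [h] with τ h2
    rw [h2]

theorem mem_KDomain_congr_ae {T ν : ℝ} {K : L2sol Ω → ℝ≥0∞} {u u' : ℝ → L2sol Ω}
    (hu : u ∈ KDomain Ω T ν K) (h : u =ᵐ[timeMeasure T] u') : u' ∈ KDomain Ω T ν K := by
  have hK : (fun τ => K (u τ)) =ᵐ[timeMeasure T] fun τ => K (u' τ) := by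
    filter_upwards [h] with τ h2
    rw [h2]
  exact ⟨hu.1.congr_ae h, hu.2.1.congr hK, by rw [← lintegral_congr_ae hK]; exact hu.2.2⟩

/-- These separated curves already suffice for the density required of an admissible `K`. -/
theorem isC1Sol_smul {h : ℝ → ℝ} (hh : ContDiff ℝ 1 h) {ψ : Eu d → Eu d} (hψ : IsSolTest Ω ψ) :
    IsC1Sol Ω (fun τ x => h τ • ψ x) := by
  have hd : ∀ τ, HasDerivAt h (deriv h τ) τ := fun τ =>
    (hh.differentiable (by simp) τ).hasDerivAt
  have ht : timeDeriv (fun τ x => h τ • ψ x) = fun τ x => deriv h τ • ψ x := by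
    ext1 τ
    ext1 x
    exact ((hd τ).smul_const (ψ x)).deriv
  refine ⟨⟨tsupport ψ, hψ.1.2.1, hψ.1.2.2, fun τ x hx => ?_⟩, fun τ => hψ.1.1.const_smul _,
    fun τ x => ?_, fun τ => ?_, fun n τ x => ?_, fun n => ?_⟩
  · rw [image_eq_zero_of_notMem_tsupport hx, smul_zero]
  · have : diverg (fun x => h τ • ψ x) x = h τ * diverg ψ x := by
      unfold diverg grad
      rw [Finset.mul_sum]
      refine Finset.sum_congr rfl fun i _ => ?_
      have := fderiv_fun_const_smul (hψ.1.1.differentiable (by simp) x) (h τ)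
      simp [this]
    rw [this, hψ.2, mul_zero]
  · rw [ht]
    exact hψ.1.1.const_smul _
  · rw [ht]
    simp only [iteratedFDeriv_fun_const_smul hψ.1.1]
    exact (hd τ).smul_const _
  · rw [ht]
    simp only [iteratedFDeriv_fun_const_smul hψ.1.1]
    refine Continuous.smul ((hh.continuous_deriv (by simp)).comp continuous_fst) ?_
    exact (hψ.1.1.continuous_iteratedFDeriv (m := n) (by exact_mod_cast le_top)).comp
      continuous_snd

/-- With `κ = ‖contract d‖`, `N` the `W^{1,∞}`-norm of `u` and `a = v - u`: for `ν = 0` the form is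
at least `-κ N ‖a‖²`, and the factor `½` in the relative energy calls for `2κ`. For `ν > 0`, Young's
inequality absorbs `κ N ‖a‖ ‖G‖` into `ν ‖G‖²` at the cost of `κ² N² ‖a‖² / (4ν)`. The extra `1` in
`regConst` keeps the constant positive, so that a finite measure implies a finite norm. -/
theorem relForm_regMeasure_nonneg {ν : ℝ} (hν : 0 ≤ ν) (v u : L2sol Ω)
    (hu : regMeasure Ω ν u ≠ ⊤) : 0 ≤ relForm ν (regMeasure Ω ν) v u := by
  have hlip : lipNorm u ≠ ⊤ := by
    intro h
    refine hu ?_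
    rw [regMeasure, h, ENNReal.top_pow (regDegree_ne_zero ν), ENNReal.mul_top]
    simpa using regConst_pos hν
  obtain ⟨h1, h2⟩ := ENNReal.add_ne_top.1 hlip
  have hK : (regMeasure Ω ν u).toReal = regConst d ν * (lipNorm u).toReal ^ regDegree ν := by
    rw [regMeasure, ENNReal.toReal_mul, ENNReal.toReal_pow,
      ENNReal.toReal_ofReal (regConst_pos hν).le]
  set N := (lipNorm u).toReal with hN
  have hN0 : 0 ≤ N := ENNReal.toReal_nonneg
  have hn1 : (eLpNorm (u : L2 Ω (Fin d)) ⊤ (volume.restrict Ω)).toReal ≤ N :=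
    ENNReal.toReal_mono hlip le_self_add
  have hn2 : (eLpNorm (weakGrad Ω (u : L2 Ω (Fin d))) ⊤ (volume.restrict Ω)).toReal ≤ N :=
    ENNReal.toReal_mono hlip le_add_self
  have hκ0 : 0 ≤ ‖contract d‖ := ContinuousLinearMap.opNorm_nonneg _
  set κ := ‖contract d‖ with hκ
  rw [relForm, hK, relEnergy]
  set a : L2 Ω (Fin d) := ((v - u : L2sol Ω) : L2 Ω (Fin d)) with ha
  have hna : ‖v - u‖ = ‖a‖ := rfl
  rw [hna]
  have hm1 : MemLp (u : L2 Ω (Fin d)) ⊤ (volume.restrict Ω) := ⟨(Lp.memLp _).1, h1.lt_top⟩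
  have hm2 : MemLp (weakGrad Ω (u : L2 Ω (Fin d))) ⊤ (volume.restrict Ω) :=
    ⟨(Lp.memLp _).1, h2.lt_top⟩
  by_cases h0 : ν = 0
  · simp only [h0, if_true, regConst, regDegree, pow_one]
    rw [symForm_eq_convForm]
    have hb := abs_convForm_le_of_bdd_mid hm2 a a
    have hb' : |convForm a (weakGrad Ω (u : L2 Ω (Fin d))) a| ≤ κ * N * ‖a‖ ^ 2 := by
      refine hb.trans ?_
      rw [mul_assoc _ ‖a‖ ‖a‖, ← pow_two]
      gcongr
    have := (abs_le.1 hb').1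
    nlinarith [mul_nonneg hN0 (sq_nonneg ‖a‖)]
  · simp only [h0, if_false, regConst, regDegree]
    have hνp : 0 < ν := lt_of_le_of_ne hν (Ne.symm h0)
    set G := weakGrad Ω (v : L2 Ω (Fin d)) - weakGrad Ω (u : L2 Ω (Fin d)) with hG
    have hb := abs_convForm_le_of_bdd_right hm1 a G
    have hb' : |convForm a G u| ≤ κ * N * ‖a‖ * ‖G‖ := by
      refine hb.trans ?_
      gcongr
    have h3 := (abs_le.1 hb').2
    have h4 : κ * N * ‖a‖ * ‖G‖ ≤ ν * ‖G‖ ^ 2 + κ ^ 2 / (2 * ν) * N ^ 2 * (1 / 2 * ‖a‖ ^ 2) := by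
      have : ν * ‖G‖ ^ 2 + κ ^ 2 / (2 * ν) * N ^ 2 * (1 / 2 * ‖a‖ ^ 2) - κ * N * ‖a‖ * ‖G‖
          = ν * (‖G‖ - κ * N * ‖a‖ / (2 * ν)) ^ 2 := by
        field_simp
        ring
      have h5 : 0 ≤ ν * (‖G‖ - κ * N * ‖a‖ / (2 * ν)) ^ 2 := by positivity
      linarith
    nlinarith [mul_nonneg (sq_nonneg N) (sq_nonneg ‖a‖)]

theorem IsC1SolOn.ae_eq_curve {T : ℝ} {u : ℝ → L2sol Ω} {φ : ℝ → Eu d → Eu d}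
    (hφ : IsC1Sol Ω φ)
    (h : ∀ τ ∈ Icc 0 T, (u τ : L2 Ω (Fin d)) =ᵐ[volume.restrict Ω] φ τ) :
    hφ.curve =ᵐ[timeMeasure T] u := by
  filter_upwards [ae_restrict_mem measurableSet_Ioo] with τ hτ
  exact Subtype.ext (Lp.ext ((hφ.curve_ae_eq τ).trans (h τ (Ioo_subset_Icc_self hτ)).symm))

theorem isSolTest_zero : IsSolTest Ω (0 : Eu d → Eu d) := by
  refine ⟨⟨contDiff_const, HasCompactSupport.zero, ?_⟩, fun x => ?_⟩
  · have : tsupport (0 : Eu d → Eu d) = ∅ := by simp [tsupport]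
    rw [this]
    exact empty_subset _
  · simp [diverg, grad]

theorem isC1Sol_zero : IsC1Sol Ω (fun _ _ => 0) := by
  have := isC1Sol_smul (contDiff_const (c := (0 : ℝ))) (isSolTest_zero (Ω := Ω))
  simp only [zero_smul] at this
  exact this

theorem toReal_regMeasure_smul (hΩ : IsOpen Ω) {ν : ℝ} (hν : 0 ≤ ν) (u : L2sol Ω) (c : ℝ) :
    (regMeasure Ω ν (c • u)).toReal
      = regConst d ν * (lipNorm u).toReal ^ regDegree ν * |c| ^ regDegree ν := by
  rw [regMeasure, lipNorm_smul hΩ, mul_pow, ENNReal.toReal_mul, ENNReal.toReal_mul,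
    ENNReal.toReal_pow, ENNReal.toReal_pow, toReal_enorm, Real.norm_eq_abs,
    ENNReal.toReal_ofReal (regConst_pos hν).le]
  ring

theorem eq_zero_of_forall_toL2_eq_zero (h : ∀ ψ, IsSolTest Ω ψ → toL2 Ω ψ = 0) (u : L2sol Ω) : u = 0 := by
  have : L2sol Ω ≤ ⊥ := by
    refine Submodule.topologicalClosure_minimal _ (Submodule.span_le.2 ?_) ?_
    · rintro u ⟨ψ, hψ, hu⟩
      have : u = toL2 Ω ψ := Lp.ext (hu.trans (toL2_ae_eq hψ.1).symm)
      rw [this, h ψ hψ]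
      exact Submodule.zero_mem _
    · exact isClosed_singleton
  exact Subtype.ext ((Submodule.mem_bot ℝ).1 (this u.2))

variable [IsFiniteMeasure (volume.restrict Ω)]

theorem curve_mem_KDomain (hΩ : IsOpen Ω) (T : ℝ) {ν : ℝ} (hν : 0 ≤ ν) {φ : ℝ → Eu d → Eu d}
    (hφ : IsC1Sol Ω φ) : hφ.curve ∈ KDomain Ω T ν (regMeasure Ω ν) := by
  obtain ⟨V, hV, hV'⟩ := hφ.exists_continuous_Lp_top_curve
  obtain ⟨D, hD, hD'⟩ := hφ.exists_continuous_Lp_top_weakGrad hΩ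
  have hlip : ∀ τ, lipNorm (hφ.curve τ) = ENNReal.ofReal (‖V τ‖ + ‖D τ‖) := by
    intro τ
    rw [ENNReal.ofReal_add (norm_nonneg _) (norm_nonneg _), ofReal_norm, ofReal_norm,
      Lp.enorm_def, Lp.enorm_def, eLpNorm_congr_ae (hV' τ), eLpNorm_congr_ae (hD' τ), lipNorm]
  have hK : ∀ τ, regMeasure Ω ν (hφ.curve τ)
      = ENNReal.ofReal (regConst d ν * (‖V τ‖ + ‖D τ‖) ^ regDegree ν) := by
    intro τ
    rw [regMeasure, hlip, ENNReal.ofReal_mul (regConst_pos hν).le, ENNReal.ofReal_pow]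
    positivity
  have hc : Continuous fun τ => regConst d ν * (‖V τ‖ + ‖D τ‖) ^ regDegree ν := by fun_prop
  refine ⟨hφ.memX_curve hΩ T ν, ?_, ?_⟩
  · simp only [hK]
    exact (ENNReal.measurable_ofReal.comp hc.measurable).aemeasurable
  · simp only [hK]
    exact (memLp_one_iff_integrable.1
      (memLp_timeMeasure_of_continuous hc T 1)).lintegral_lt_top.ne

theorem isAdmissible_regMeasure (hΩ : IsOpen Ω) {T ν : ℝ} (hν : 0 ≤ ν) :
    IsAdmissible Ω T ν (regMeasure Ω ν) where
  map_zero := regMeasure_zero hΩ ν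
  subset_domain := by
    rintro u ⟨φ, hφ, hu⟩
    exact mem_KDomain_congr_ae (curve_mem_KDomain hΩ T hν hφ) (IsC1SolOn.ae_eq_curve hφ hu)
  exists_topology := by
    -- With the coarsest topology that makes `KMap` continuous, density only asks that the function
    -- `K(u)` be approximated in `L¹(0,T)` by `K` of smooth curves.
    refine ⟨TopologicalSpace.induced (KMap Ω T ν (regMeasure Ω ν)) inferInstance,
      continuous_induced_dom, fun u => ?_⟩
    rw [closure_induced, Metric.mem_closure_iff]
    intro ε hε
    -- If all solenoidal test fields vanish, then `L²_σ = 0` and `u` itself is a smooth curve.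
    -- Otherwise a single nonzero field `U` with polynomial coefficients in time is enough.
    by_cases htriv : ∀ ψ, IsSolTest Ω ψ → toL2 Ω ψ = 0
    · refine ⟨_, ⟨u, ⟨fun _ _ => 0, ?_, fun τ _ => ?_⟩, rfl⟩, by simpa using hε⟩
      · exact isC1Sol_zero
      · rw [eq_zero_of_forall_toL2_eq_zero htriv ((u : ℝ → L2sol Ω) τ)]
        exact Lp.coeFn_zero _ _ _
    push Not at htriv
    obtain ⟨ψ, hψ, hψ0⟩ := htriv
    set U : L2sol Ω := ⟨toL2 Ω ψ, toL2_mem_L2sol hψ⟩ with hU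
    have hU0 : lipNorm U ≠ 0 := by
      intro h
      have h1 : eLpNorm (toL2 Ω ψ) ⊤ (volume.restrict Ω) = 0 := (add_eq_zero.1 h).1
      rw [eLpNorm_eq_zero_iff (Lp.memLp _).1 (by simp)] at h1
      exact hψ0 (Lp.eq_zero_iff_ae_eq_zero.2 h1)
    have hUtop : lipNorm U ≠ ⊤ := by
      refine ENNReal.add_ne_top.2 ⟨?_, ?_⟩
      · exact (hψ.1.memLp_top_of_ae_eq (toL2_ae_eq hψ.1)).eLpNorm_ne_top
      · exact (hψ.1.jacobian.memLp_top_of_ae_eq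
          (hψ.1.weakGrad_ae_eq hΩ (toL2_ae_eq hψ.1)).2).eLpNorm_ne_top
    have hn0 : 0 < (lipNorm U).toReal := ENNReal.toReal_pos hU0 hUtop
    have hgi := integrable_toReal_of_lintegral_ne_top u.2.2.1 u.2.2.2
    obtain ⟨p, hp⟩ := exists_polynomial_integral_abs_pow_sub_lt
      (A := regConst d ν * (lipNorm U).toReal ^ regDegree ν)
      (mul_pos (regConst_pos hν) (pow_pos hn0 _)) (regDegree_ne_zero ν) hgi
      (fun τ => ENNReal.toReal_nonneg) hε
    have hpc : ContDiff ℝ 1 fun τ => p.eval τ := by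
      have := p.contDiff_aeval (𝕜 := ℝ) 1
      simp only [Polynomial.coe_aeval_eq_eval] at this
      exact this
    have hφ := isC1Sol_smul hpc hψ
    have hcurve : ∀ τ, hφ.curve τ = p.eval τ • U := fun τ =>
      Subtype.ext (toL2_smul (p.eval τ) hψ.1)
    have hmem := curve_mem_KDomain hΩ T hν hφ
    refine ⟨_, ⟨⟨hφ.curve, hmem⟩, ⟨_, hφ, fun τ _ => hφ.curve_ae_eq τ⟩, rfl⟩, ?_⟩
    have hwi := integrable_toReal_of_lintegral_ne_top hmem.2.1 hmem.2.2
    rw [dist_comm, dist_eq_norm, KMap, KMap, ← Integrable.toL1_sub _ _ hwi hgi,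
      L1.norm_of_fun_eq_integral_norm]
    refine lt_of_eq_of_lt (integral_congr_ae (.of_forall fun τ => ?_)) hp
    simp only [Pi.sub_apply, hcurve, toReal_regMeasure_smul hΩ hν, Real.norm_eq_abs]
  relForm_nonneg := by
    intro v hv u w hu hK
    filter_upwards [ae_lt_top' hK.2.1 hK.2.2] with τ hτ
    exact relForm_regMeasure_nonneg hν _ _ hτ.ne

end RegularityMeasure

/-! ### One-sided essential limits -/

section EssentialLimits

/-- An interval to the right of `t` has positive measure. Nontriviality of the filter makes
essential limits unique, so that boundary values obtained from different test curves can be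
identified. -/
theorem nhdsGT_inf_ae_neBot (t : ℝ) : (𝓝[>] t ⊓ ae (volume : Measure ℝ)).NeBot := by
  rw [inf_neBot_iff]
  intro s hs s' hs'
  obtain ⟨r, hr, hrs⟩ := (mem_nhdsGT_iff_exists_Ioo_subset).1 hs
  by_contra h
  rw [not_nonempty_iff_eq_empty] at h
  have h1 : Ioo t r ⊆ s'ᶜ := fun x hx hx' => by
    have : x ∈ s ∩ s' := ⟨hrs hx, hx'⟩
    simp [h] at this
  have h2 : volume (Ioo t r) = 0 := measure_mono_null h1 (mem_ae_iff.1 hs')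
  rw [Real.volume_Ioo, ENNReal.ofReal_eq_zero] at h2
  linarith [mem_Ioi.1 hr]

theorem nhdsLT_inf_ae_neBot (t : ℝ) : (𝓝[<] t ⊓ ae (volume : Measure ℝ)).NeBot := by
  rw [inf_neBot_iff]
  intro s hs s' hs'
  obtain ⟨r, hr, hrs⟩ := (mem_nhdsLT_iff_exists_Ioo_subset).1 hs
  by_contra h
  rw [not_nonempty_iff_eq_empty] at h
  have h1 : Ioo r t ⊆ s'ᶜ := fun x hx hx' => by
    have : x ∈ s ∩ s' := ⟨hrs hx, hx'⟩
    simp [h] at this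
  have h2 : volume (Ioo r t) = 0 := measure_mono_null h1 (mem_ae_iff.1 hs')
  rw [Real.volume_Ioo, ENNReal.ofReal_eq_zero] at h2
  linarith [mem_Iio.1 hr]

/-- At almost every point, essential one-sided limits of a locally integrable function agree
with its value. -/
theorem ae_eq_of_tendsto_inf_ae {E : ℝ → ℝ} (hE : LocallyIntegrable E volume) :
    ∀ᵐ q, (∀ b, Tendsto E (𝓝[<] q ⊓ ae volume) (𝓝 b) → b = E q) ∧
      ∀ b, Tendsto E (𝓝[>] q ⊓ ae volume) (𝓝 b) → b = E q := by
  filter_upwards [LocallyIntegrable.ae_hasDerivAt_integral hE] with q hq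
  have hintegral : IntervalIntegrable E volume q q := by simp
  have hmeas : ∀ l : Filter ℝ, StronglyMeasurableAtFilter E l volume := fun l =>
    hE.aestronglyMeasurable.stronglyMeasurableAtFilter
  refine ⟨fun b hb => ?_, fun b hb => ?_⟩
  -- The left-hand version of the fundamental theorem uses `𝓝[≤] q`; the added point is null. An
  -- essential one-sided limit is then a one-sided derivative of the primitive, whose derivative at
  -- a Lebesgue point is `E q`.
  · have hle : 𝓝[≤] q ⊓ ae (volume : Measure ℝ) ≤ 𝓝[<] q ⊓ ae volume := by
      refine le_inf ?_ inf_le_right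
      have h1 : {q}ᶜ ∈ ae (volume : Measure ℝ) := by simp [mem_ae_iff]
      intro s hs
      rw [mem_nhdsWithin] at hs
      obtain ⟨o, ho, hqo, hos⟩ := hs
      refine mem_of_superset (inter_mem (mem_inf_of_left
        (inter_mem (mem_nhdsWithin_of_mem_nhds (ho.mem_nhds hqo)) self_mem_nhdsWithin))
        (mem_inf_of_right h1)) ?_
      rintro x ⟨⟨hx1, hx2⟩, hx3⟩
      exact hos ⟨hx1, lt_of_le_of_ne hx2 hx3⟩
    have h1 := intervalIntegral.integral_hasDerivWithinAt_of_tendsto_ae_right (s := Iic q)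
      (t := Iic q) hintegral (hmeas _) (hb.mono_left hle)
    exact (uniqueDiffWithinAt_Iic q).eq_deriv _ h1 (hq q).hasDerivWithinAt
  · have h1 := intervalIntegral.integral_hasDerivWithinAt_of_tendsto_ae_right (s := Ici q)
      (t := Ioi q) hintegral (hmeas _) hb
    exact (uniqueDiffWithinAt_Ici q).eq_deriv _ h1 (hq q).hasDerivWithinAt

end EssentialLimits

/-! ### The force -/

section Force

variable {d : ℕ} {Ω : Set (Eu d)}

theorem hm1Pair_eq {F : Hm1 Ω} {u : L2 Ω (Fin d)} (h : (u, weakGrad Ω u) ∈ H10 Ω) :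
    hm1Pair F u = F ⟨(u, weakGrad Ω u), h⟩ := by
  rw [hm1Pair, dif_pos h]

theorem hm1Pair_zero_left (u : L2 Ω (Fin d)) : hm1Pair (0 : Hm1 Ω) u = 0 := by
  unfold hm1Pair
  split_ifs <;> simp

theorem hm1Pair_sub (hΩ : IsOpen Ω) (F : Hm1 Ω) {u u' : L2 Ω (Fin d)}
    (h : (u, weakGrad Ω u) ∈ H10 Ω) (h' : (u', weakGrad Ω u') ∈ H10 Ω) :
    hm1Pair F (u - u') = hm1Pair F u - hm1Pair F u' := by
  have hg : weakGrad Ω (u - u') = weakGrad Ω u - weakGrad Ω u' :=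
    ((isWeakGrad_of_mem_H10 h).sub (isWeakGrad_of_mem_H10 h')).weakGrad_eq hΩ
  have hmem : (u - u', weakGrad Ω (u - u')) ∈ H10 Ω := by
    rw [hg]
    exact (H10 Ω).sub_mem h h'
  rw [hm1Pair_eq h, hm1Pair_eq h', hm1Pair_eq hmem, ← map_sub]
  congr 1
  exact Subtype.ext (Prod.ext rfl hg)

theorem hm1Pair_smul (hΩ : IsOpen Ω) (F : Hm1 Ω) {u : L2 Ω (Fin d)}
    (h : (u, weakGrad Ω u) ∈ H10 Ω) (c : ℝ) :
    hm1Pair F (c • u) = c * hm1Pair F u := by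
  have hg : weakGrad Ω (c • u) = c • weakGrad Ω u := weakGrad_const_smul hΩ c u
  have hmem : (c • u, weakGrad Ω (c • u)) ∈ H10 Ω := by
    rw [hg]
    exact (H10 Ω).smul_mem c h
  rw [hm1Pair_eq h, hm1Pair_eq hmem, ← smul_eq_mul, ← map_smul]
  congr 1
  exact Subtype.ext (Prod.ext rfl hg)

theorem forcePair_smul (hΩ : IsOpen Ω) (F : Hm1 Ω × L2 Ω (Fin d)) {u : L2 Ω (Fin d)}
    (h : (u, weakGrad Ω u) ∈ H10 Ω) (c : ℝ) :
    forcePair F (c • u) = c * forcePair F u := by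
  rw [forcePair, forcePair, hm1Pair_smul hΩ F.1 h, real_inner_smul_right]
  ring

/-- For `ν = 0` the fields need not lie in `H¹₀`, where the default value of `hm1Pair` would break
additivity; the vanishing of the `H⁻¹` part rescues it. -/
theorem forcePair_sub (hΩ : IsOpen Ω) {ν : ℝ} (hν : 0 ≤ ν) {F : Hm1 Ω × L2 Ω (Fin d)}
    (hF : ν = 0 → F.1 = 0) {u u' : L2 Ω (Fin d)}
    (h : 0 < ν → (u, weakGrad Ω u) ∈ H10 Ω) (h' : 0 < ν → (u', weakGrad Ω u') ∈ H10 Ω) :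
    forcePair F (u - u') = forcePair F u - forcePair F u' := by
  simp only [forcePair, inner_sub_right]
  rcases hν.eq_or_lt with h0 | h0
  · rw [hF h0.symm]
    simp only [hm1Pair_zero_left]
    ring
  · rw [hm1Pair_sub hΩ F.1 (h h0) (h' h0)]
    ring

theorem integrable_inner_of_memLp {α E : Type*} [MeasurableSpace α] {μ : Measure α}
    [NormedAddCommGroup E] [InnerProductSpace ℝ E] {p q : ℝ≥0∞} [p.HolderTriple q 1]
    {g h : α → E} (hg : MemLp g p μ) (hh : MemLp h q μ) :
    Integrable (fun x => inner ℝ (g x) (h x)) μ := by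
  refine memLp_one_iff_integrable.1 (MemLp.of_bilin (r := 1) (fun x y => inner ℝ x y) 1 hg hh
    (hg.1.inner hh.1) (.of_forall fun x => ?_))
  simpa using nnnorm_inner_le_nnnorm (𝕜 := ℝ) (g x) (h x)

open Classical in
theorem integrable_dual_apply_of_ae_mem {α P : Type*} [MeasurableSpace α] {μ : Measure α}
    [NormedAddCommGroup P] [NormedSpace ℝ P] {S : Submodule ℝ P} {x : α → P}
    (hx : MemLp x 2 μ) (hxS : ∀ᵐ τ ∂μ, x τ ∈ S) {F : α → StrongDual ℝ S} (hF : MemLp F 2 μ) :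
    Integrable (fun τ => if h : x τ ∈ S then F τ ⟨x τ, h⟩ else 0) μ := by
  -- An `S`-valued version of `x`. Its measurability comes from that of `x`, since the inclusion of
  -- `S` is an embedding, and the pairing with `F` is a continuous bilinear map.
  set X : α → S := fun τ => if h : x τ ∈ S then ⟨_, h⟩ else 0 with hX
  have hpair : ∀ τ, (if h : x τ ∈ S then F τ ⟨x τ, h⟩ else 0) = F τ (X τ) := by
    intro τ
    simp only [hX]
    split_ifs <;> simp
  have hXc : x =ᵐ[μ] fun τ => (X τ : P) := by
    filter_upwards [hxS] with τ hτ
    simp only [hX, dif_pos hτ]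
  have hX2 : MemLp X 2 μ := by
    have h1 := (memLp_congr_ae hXc).1 hx
    refine ⟨?_, ?_⟩
    · exact (Topology.IsEmbedding.subtypeVal.aestronglyMeasurable_comp_iff).1 h1.1
    · exact lt_of_eq_of_lt (eLpNorm_congr_norm_ae (.of_forall fun τ => rfl)) h1.2
  simp only [hpair]
  have hm : AEStronglyMeasurable (fun τ => F τ (X τ)) μ :=
    (isBoundedBilinearMap_apply (𝕜 := ℝ) (E := S) (F := ℝ)).continuous.comp_aestronglyMeasurable
      (hF.1.prodMk hX2.1)
  refine memLp_one_iff_integrable.1 (MemLp.of_bilin (p := 2) (q := 2) (r := 1)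
    (fun (ℓ : StrongDual ℝ S) (y : S) => ℓ y) 1 hF hX2 hm (.of_forall fun τ => ?_))
  rw [one_mul]
  exact (F τ).le_opNNNorm (X τ)

theorem MemX.integrable_hm1Pair {T ν : ℝ} (hν : 0 < ν) {v : ℝ → L2sol Ω}
    (hv : MemX Ω T ν v) {F : ℝ → Hm1 Ω} (hF : MemLp F 2 (timeMeasure T)) :
    Integrable (fun τ => hm1Pair (F τ) (v τ)) (timeMeasure T) := by
  have hv2 : MemLp (fun τ => (v τ : L2 Ω (Fin d))) 2 (timeMeasure T) :=
    (L2sol Ω).subtypeL.comp_memLp' (hv.bounded.mono_exponent le_top)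
  have hp : MemLp (fun τ => ((v τ : L2 Ω (Fin d)), weakGrad Ω (v τ : L2 Ω (Fin d)))) 2
      (timeMeasure T) := memLp_prod_iff.2 ⟨hv2, hv.grad_memLp hν⟩
  exact integrable_dual_apply_of_ae_mem hp
    ((hv.mem_H10sol hν).mono fun τ hτ => H10sol_le_H10 hτ) hF

theorem MemX.integrable_forcePair {T ν : ℝ} (hν : 0 ≤ ν) {v : ℝ → L2sol Ω}
    (hv : MemX Ω T ν v) {f : ℝ → Hm1 Ω × L2 Ω (Fin d)} (hf : MemZ Ω T ν f) :
    Integrable (fun τ => forcePair (f τ) (v τ)) (timeMeasure T) := by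
  have hv1 : MemLp (fun τ => (v τ : L2 Ω (Fin d))) ⊤ (timeMeasure T) :=
    (L2sol Ω).subtypeL.comp_memLp' hv.bounded
  have h1 : Integrable (fun τ => hm1Pair (f τ).1 (v τ)) (timeMeasure T) := by
    rcases hν.eq_or_lt with h0 | h0
    · refine (integrable_zero ℝ ℝ (timeMeasure T)).congr ?_
      filter_upwards [hf.fst_eq_zero h0.symm] with τ hτ
      rw [hτ, hm1Pair_zero_left]
      rfl
    · exact hv.integrable_hm1Pair h0 hf.fst_memLp
  exact h1.add (integrable_inner_of_memLp hf.snd_memLp hv1)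

end Force

/-! ### The relative energy inequality for smooth test functions -/

section RelativeEnergy

variable {d : ℕ} {Ω : Set (Eu d)}

/-- The dissipation and power of the force in the energy balance at a fixed time. -/
def energyRate (ν : ℝ) (F : Hm1 Ω × L2 Ω (Fin d)) (v : L2 Ω (Fin d)) : ℝ :=
  ν * ‖weakGrad Ω v‖ ^ 2 - forcePair F v

/-- The integrand of the weak formulation at a fixed time. -/
def weakRate (ν : ℝ) (F : Hm1 Ω × L2 Ω (Fin d)) (v u w : L2 Ω (Fin d)) : ℝ :=
  ν * inner ℝ (weakGrad Ω v) (weakGrad Ω u) - convForm v (weakGrad Ω u) v - inner ℝ v w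
    - forcePair F u

/-- The `+ 0` is the place of `ξ`; there the terms with `K` cancel. For `ν > 0` the viscous terms
give `ν‖∇v‖² - ν(∇v, ∇u)`. In both cases skewness (`convForm_eq_neg`) reduces the convective terms
to `convForm v (∇u) v`: those with two factors `u` next to `∇u` vanish, and the others with `∇v` are
moved onto `∇u`. -/
theorem relForm_add_systemOp_sub (hΩ : IsOpen Ω) {ν : ℝ} (hν : 0 ≤ ν)
    {F : Hm1 Ω × L2 Ω (Fin d)} (hF : ν = 0 → F.1 = 0) {v : L2sol Ω}
    (hv : 0 < ν → ((v : L2 Ω (Fin d)), weakGrad Ω (v : L2 Ω (Fin d))) ∈ H10sol Ω)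
    {φ : Eu d → Eu d} (hφ : IsSolTest Ω φ) {u : L2sol Ω} (hu : (u : L2 Ω (Fin d)) = toL2 Ω φ)
    (w : L2sol Ω) (K : L2sol Ω → ℝ≥0∞) :
    relForm ν K v u + systemOp ν F u w ((v - u : L2sol Ω) : L2 Ω (Fin d))
        - (K u).toReal * (relEnergy v u + 0)
      = energyRate ν F v - weakRate ν F v u w - inner ℝ w u := by
  have hut := hφ.1
  have hue : (u : L2 Ω (Fin d)) =ᵐ[volume.restrict Ω] φ := hu ▸ toL2_ae_eq hφ.1
  obtain ⟨hug, hug'⟩ := hut.weakGrad_ae_eq hΩ hue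
  have hum : MemLp (u : L2 Ω (Fin d)) ⊤ (volume.restrict Ω) := hut.memLp_top_of_ae_eq hue
  have hgm : MemLp (weakGrad Ω (u : L2 Ω (Fin d))) ⊤ (volume.restrict Ω) :=
    hut.jacobian.memLp_top_of_ae_eq hug'
  have huH : ((u : L2 Ω (Fin d)), weakGrad Ω (u : L2 Ω (Fin d))) ∈ H10 Ω :=
    H10sol_le_H10 (hu ▸ hφ.mem_H10sol hΩ)
  have hvuu := convForm_eq_neg hΩ v.2 hug hut hue
  have huuu := convForm_eq_neg hΩ u.2 hug hut hue
  have hforce := forcePair_sub hΩ hν hF (fun h => H10sol_le_H10 (hv h)) (fun _ => huH)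
  have hw : inner ℝ (w : L2 Ω (Fin d)) ((v : L2 Ω (Fin d)) - u)
      = inner ℝ (v : L2 Ω (Fin d)) w - inner ℝ w u := by
    rw [inner_sub_right, real_inner_comm]
    rfl
  simp only [relForm, systemOp, energyRate, weakRate, Submodule.coe_sub, hforce, hw]
  by_cases h0 : ν = 0
  · simp only [h0, if_true, symForm_eq_convForm, convForm_sub_left_of_bdd_mid hgm,
      convForm_sub_right hgm]
    linarith
  · have hνp : 0 < ν := lt_of_le_of_ne hν (Ne.symm h0)
    have hvg := isWeakGrad_of_mem_H10 (H10sol_le_H10 (hv hνp))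
    simp only at hvg
    have hvvu := convForm_eq_neg hΩ v.2 hvg hut hue
    have huvu := convForm_eq_neg hΩ u.2 hvg hut hue
    rw [laplaceForm_eq_neg_inner hΩ hut hue (hvg.sub hug)]
    simp only [h0, if_false, convForm_sub_left hum, convForm_sub_mid hum,
      convForm_sub_right hgm]
    rw [norm_sub_sq_real, inner_sub_left, real_inner_self_eq_norm_sq]
    linarith

theorem MemX.integrable_energyRate {T ν : ℝ} (hν : 0 ≤ ν) {v : ℝ → L2sol Ω}
    (hv : MemX Ω T ν v) {f : ℝ → Hm1 Ω × L2 Ω (Fin d)} (hf : MemZ Ω T ν f) :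
    Integrable (fun τ => energyRate ν (f τ) (v τ)) (timeMeasure T) := by
  refine Integrable.sub ?_ (hv.integrable_forcePair hν hf)
  rcases hν.eq_or_lt with h0 | h0
  · simp [← h0]
  · exact ((hv.grad_memLp h0).integrable_norm_pow (by norm_num)).const_mul ν

variable [IsFiniteMeasure (volume.restrict Ω)]

theorem MemX.integrable_weakRate (hΩ : IsOpen Ω) {T ν : ℝ} (hν : 0 ≤ ν) {v : ℝ → L2sol Ω}
    (hv : MemX Ω T ν v) {f : ℝ → Hm1 Ω × L2 Ω (Fin d)} (hf : MemZ Ω T ν f)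
    {φ : ℝ → Eu d → Eu d} (hφ : IsC1Sol Ω φ) :
    Integrable (fun τ => weakRate ν (f τ) (v τ) (hφ.curve τ) (hφ.velocity τ))
      (timeMeasure T) := by
  have hv1 : MemLp (fun τ => (v τ : L2 Ω (Fin d))) ⊤ (timeMeasure T) :=
    (L2sol Ω).subtypeL.comp_memLp' hv.bounded
  have hw : MemLp (fun τ => (hφ.velocity τ : L2 Ω (Fin d))) 1 (timeMeasure T) :=
    memLp_timeMeasure_of_continuous (continuous_subtype_val.comp hφ.continuous_velocity) T 1
  refine Integrable.sub (Integrable.sub (Integrable.sub ?_ ?_) ?_)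
    ((hφ.memX_curve hΩ T ν).integrable_forcePair hν hf)
  · rcases hν.eq_or_lt with h0 | h0
    · simp [← h0]
    · exact (integrable_inner_of_memLp (hv.grad_memLp h0)
        (memLp_timeMeasure_of_continuous (hφ.continuous_weakGrad hΩ) T 2)).const_mul ν
  · obtain ⟨D, hD, hD'⟩ := hφ.exists_continuous_Lp_top_weakGrad hΩ
    simp only [convForm_eq_inner_of_bdd_mid (hD' _)]
    have h1 : MemLp (fun τ => (contract d).holder 2 (D τ) (v τ : L2 Ω (Fin d))) 1
        (timeMeasure T) :=
      ((contract d).holderL (volume.restrict Ω) ⊤ 2 2).memLp_of_bilin 1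
        (memLp_timeMeasure_of_continuous hD T 1) hv1
    exact integrable_inner_of_memLp hv1 h1
  · exact integrable_inner_of_memLp hv1 hw

end RelativeEnergy

/-! ### The energy inequality and the weak formulation on an interval where `ξ` vanishes -/

section Solutions

variable {d : ℕ} {Ω : Set (Eu d)}

theorem ae_restrict_Ioc_of_ae_timeMeasure {T q r : ℝ} (hq : 0 ≤ q) (hr : r ≤ T) {P : ℝ → Prop}
    (h : ∀ᵐ τ ∂(timeMeasure T), P τ) : ∀ᵐ τ ∂(volume.restrict (Ioc q r)), P τ := by
  rw [← Measure.restrict_congr_set Ioo_ae_eq_Ioc]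
  exact ae_mono (Measure.restrict_mono (Ioo_subset_Ioo hq hr) le_rfl) h

theorem intervalIntegrable_of_integrable_timeMeasure {T q r : ℝ} (hq : 0 ≤ q) (hqr : q ≤ r)
    (hr : r ≤ T) {g : ℝ → ℝ} (hg : Integrable g (timeMeasure T)) :
    IntervalIntegrable g volume q r := by
  rw [intervalIntegrable_iff_integrableOn_Ioo_of_le hqr]
  exact IntegrableOn.mono_set (t := Ioo 0 T) hg (Ioo_subset_Ioo hq hr)

theorem IsC1Sol.weakRate_eq (hΩ : IsOpen Ω) {φ : ℝ → Eu d → Eu d} (hφ : IsC1Sol Ω φ) (ν : ℝ)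
    (F : Hm1 Ω × L2 Ω (Fin d)) (v : L2 Ω (Fin d)) (τ : ℝ) :
    weakRate ν F v (hφ.curve τ) (hφ.velocity τ) =
      ν * (∫ x in Ω, inner ℝ (weakGrad Ω v x) (grad (φ τ) x))
        - (∫ x in Ω, ∑ i, ∑ j, v x i * v x j * grad (φ τ) x (i, j))
        - (∫ x in Ω, inner ℝ (v x) (timeDeriv φ τ x))
        - forcePair F (toL2 Ω (φ τ)) := by
  have hG := hφ.weakGrad_curve_ae_eq hΩ τ
  have h1 : inner ℝ (weakGrad Ω v) (weakGrad Ω (hφ.curve τ : L2 Ω (Fin d)))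
      = ∫ x in Ω, inner ℝ (weakGrad Ω v x) (grad (φ τ) x) := by
    rw [L2.inner_def]
    refine integral_congr_ae ?_
    filter_upwards [hG] with x hx
    rw [hx, grad_eq_jacobian]
  have h2 : convForm v (weakGrad Ω (hφ.curve τ : L2 Ω (Fin d))) v
      = ∫ x in Ω, ∑ i, ∑ j, v x i * v x j * grad (φ τ) x (i, j) := by
    rw [convForm]
    refine integral_congr_ae ?_
    filter_upwards [hG] with x hx
    rw [hx, grad_eq_jacobian]
    exact Finset.sum_congr rfl fun i _ => Finset.sum_congr rfl fun j _ => by ring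
  have h3 : inner ℝ v (hφ.velocity τ : L2 Ω (Fin d))
      = ∫ x in Ω, inner ℝ (v x) (timeDeriv φ τ x) := by
    rw [L2.inner_def]
    refine integral_congr_ae ?_
    filter_upwards [hφ.velocity_ae_eq τ] with x hx
    rw [hx]
  rw [weakRate, h1, h2, h3]
  rfl

theorem IsC1Sol.curve_const_smul {φ : ℝ → Eu d → Eu d} (hφ : IsC1Sol Ω φ) (c τ : ℝ) :
    (hφ.const_smul c).curve τ = c • hφ.curve τ :=
  Subtype.ext (toL2_smul c (hφ.isSolTest τ).1)

theorem IsC1Sol.velocity_const_smul {φ : ℝ → Eu d → Eu d} (hφ : IsC1Sol Ω φ) (c τ : ℝ) :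
    (hφ.const_smul c).velocity τ = c • hφ.velocity τ := by
  refine Subtype.ext ?_
  have ht : timeDeriv (fun τ x => c • φ τ x) τ = fun x => c • timeDeriv φ τ x := by
    ext1 x
    exact ((hφ.hasDerivAt_apply τ x).const_smul c).deriv
  change toL2 Ω (timeDeriv (fun τ x => c • φ τ x) τ) = c • toL2 Ω (timeDeriv φ τ)
  rw [ht, toL2_smul c (hφ.isSolTest_timeDeriv τ).1]

theorem IsC1Sol.weakRate_const_smul (hΩ : IsOpen Ω) {φ : ℝ → Eu d → Eu d} (hφ : IsC1Sol Ω φ)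
    (ν : ℝ) (F : Hm1 Ω × L2 Ω (Fin d)) (v : L2 Ω (Fin d)) (c τ : ℝ) :
    weakRate ν F v ((hφ.const_smul c).curve τ) ((hφ.const_smul c).velocity τ) =
      c * weakRate ν F v (hφ.curve τ) (hφ.velocity τ) := by
  have hH : ((hφ.curve τ : L2 Ω (Fin d)), weakGrad Ω (hφ.curve τ : L2 Ω (Fin d))) ∈ H10 Ω :=
    H10sol_le_H10 ((hφ.isSolTest τ).mem_H10sol hΩ)
  have hconv : ∀ G : L2 Ω (Fin d × Fin d), convForm v (c • G) v = c * convForm v G v := by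
    intro G
    rw [convForm, convForm, ← integral_const_mul]
    refine integral_congr_ae ?_
    filter_upwards [Lp.coeFn_smul c G] with x hx
    rw [hx]
    simp only [Pi.smul_apply, PiLp.smul_apply, smul_eq_mul, Finset.mul_sum]
    exact Finset.sum_congr rfl fun i _ => Finset.sum_congr rfl fun j _ => by ring
  rw [hφ.curve_const_smul, hφ.velocity_const_smul, weakRate, weakRate, Submodule.coe_smul,
    Submodule.coe_smul, weakGrad_const_smul hΩ, hconv, forcePair_smul hΩ F hH,
    real_inner_smul_right, real_inner_smul_right]
  ring

theorem IsSolution.locallyIntegrable_energy {T ν : ℝ}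
    {f : ℝ → Hm1 Ω × L2 Ω (Fin d)} {v₀ : L2sol Ω} {v : ℝ → L2sol Ω}
    {ξ : ℝ → ℝ} (hv : IsSolution Ω T ν f v₀ v ξ) :
    LocallyIntegrable ((Ioo 0 T).indicator fun τ => relEnergy (v τ) 0 + ξ τ) volume := by
  refine Integrable.locallyIntegrable ?_
  rw [integrable_indicator_iff measurableSet_Ioo]
  refine Integrable.add ?_ (memLp_one_iff_integrable.1 (hv.memLp.mono_exponent le_top))
  have h2 : MemLp v 2 (timeMeasure T) := hv.memX.bounded.mono_exponent le_top
  simpa [relEnergy] using (h2.integrable_norm_pow (by norm_num)).const_mul (1 / 2 : ℝ)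

variable [IsFiniteMeasure (volume.restrict Ω)]

theorem IsC1Sol.integral_inner_velocity_curve {φ : ℝ → Eu d → Eu d} (hφ : IsC1Sol Ω φ)
    {q r : ℝ} (hq : hφ.curve q = 0) (hr : hφ.curve r = 0) :
    ∫ τ in q..r, inner ℝ (hφ.velocity τ) (hφ.curve τ) = 0 := by
  have h1 : ∀ τ, HasDerivAt (fun σ => 1 / 2 * ‖hφ.curve σ‖ ^ 2)
      (inner ℝ (hφ.velocity τ) (hφ.curve τ)) τ := by
    intro τ
    have := ((hφ.hasDerivAt_curve τ).norm_sq).const_mul (1 / 2 : ℝ)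
    rw [real_inner_comm]
    refine this.congr_deriv ?_
    rw [← mul_assoc]
    norm_num
  rw [intervalIntegral.integral_eq_sub_of_hasDerivAt (fun τ _ => h1 τ)]
  · simp [hq, hr]
  · exact (hφ.continuous_velocity.inner hφ.continuous_curve).intervalIntegrable q r

/-- Because the curve vanishes at `q` and `r`, the boundary terms involve only `v` and `ξ`, and the
contribution of `⟨∂ₜu, u⟩` integrates to zero. -/
theorem IsSolution.energy_le_of_isC1Sol (hΩ : IsOpen Ω) {T ν : ℝ} (hν : 0 ≤ ν)
    {f : ℝ → Hm1 Ω × L2 Ω (Fin d)} (hf : MemZ Ω T ν f) {v₀ : L2sol Ω} {v : ℝ → L2sol Ω}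
    {ξ : ℝ → ℝ} (hv : IsSolution Ω T ν f v₀ v ξ) {q r : ℝ} (hq : 0 ≤ q) (hqr : q ≤ r)
    (hr : r ≤ T) (hξ : ∀ᵐ τ ∂(volume.restrict (Ioo q r)), ξ τ = 0) {φ : ℝ → Eu d → Eu d}
    (hφ : IsC1Sol Ω φ) (hφq : hφ.curve q = 0) (hφr : hφ.curve r = 0) :
    ∃ a b : ℝ, Tendsto (fun τ => relEnergy (v τ) 0 + ξ τ) (rightLim T r) (𝓝 a) ∧
      Tendsto (fun τ => relEnergy (v τ) 0 + ξ τ) (leftLim q) (𝓝 b) ∧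
      a + ((∫ τ in q..r, energyRate ν (f τ) (v τ))
        - ∫ τ in q..r, weakRate ν (f τ) (v τ) (hφ.curve τ) (hφ.velocity τ)) ≤ b := by
  obtain ⟨a, b, ha, hb, hab⟩ := hv.relative_energy _ (isAdmissible_regMeasure hΩ hν) _ _
    (hφ.memY_curve hΩ T ν) (curve_mem_KDomain hΩ T hν hφ) q r hq hqr hr
  rw [hφr] at ha
  rw [hφq] at hb
  refine ⟨a, b, ha, hb, le_of_eq_of_le ?_ hab⟩
  congr 1
  have hc := intervalIntegrable_of_integrable_timeMeasure hq hqr hr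
    (hv.memX.integrable_energyRate hν hf)
  have hl := intervalIntegrable_of_integrable_timeMeasure hq hqr hr
    (hv.memX.integrable_weakRate hΩ hν hf hφ)
  have hk : IntervalIntegrable (fun τ => inner ℝ (hφ.velocity τ) (hφ.curve τ)) volume q r :=
    (hφ.continuous_velocity.inner hφ.continuous_curve).intervalIntegrable q r
  rw [← intervalIntegral.integral_sub hc hl, ← sub_zero (∫ τ in q..r, _),
    ← hφ.integral_inner_velocity_curve hφq hφr, ← intervalIntegral.integral_sub (hc.sub hl) hk]
  refine intervalIntegral.integral_congr_ae_restrict ?_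
  rw [uIoc_of_le hqr]
  have hξ' : ∀ᵐ τ ∂(volume.restrict (Ioc q r)), ξ τ = 0 := by
    rwa [← Measure.restrict_congr_set Ioo_ae_eq_Ioc]
  have hF : ∀ᵐ τ ∂(volume.restrict (Ioc q r)), ν = 0 → (f τ).1 = 0 := by
    by_cases h0 : ν = 0
    · exact (ae_restrict_Ioc_of_ae_timeMeasure hq hr (hf.fst_eq_zero h0)).mono fun _ h _ => h
    · exact .of_forall fun _ h => absurd h h0
  have hH : ∀ᵐ τ ∂(volume.restrict (Ioc q r)), 0 < ν →
      ((v τ : L2 Ω (Fin d)), weakGrad Ω (v τ : L2 Ω (Fin d))) ∈ H10sol Ω := by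
    by_cases h0 : 0 < ν
    · exact (ae_restrict_Ioc_of_ae_timeMeasure hq hr (hv.memX.mem_H10sol h0)).mono
        fun _ h _ => h
    · exact .of_forall fun _ h => absurd h h0
  filter_upwards [hξ', hF, hH] with τ h1 h2 h3
  rw [h1]
  exact (relForm_add_systemOp_sub hΩ hν h2 h3 (hφ.isSolTest τ) rfl _ _).symm

theorem IsSolution.exists_null_energy_le (hΩ : IsOpen Ω) {T ν : ℝ} (hν : 0 ≤ ν)
    {f : ℝ → Hm1 Ω × L2 Ω (Fin d)} (hf : MemZ Ω T ν f) {v₀ : L2sol Ω} {v : ℝ → L2sol Ω}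
    {ξ : ℝ → ℝ} (hv : IsSolution Ω T ν f v₀ v ξ) {s t : ℝ} (hs : 0 < s) (ht : t < T)
    (hξ : ∀ᵐ τ ∂(volume.restrict (Ioo s t)), ξ τ = 0) :
    ∃ N : Set ℝ, volume N = 0 ∧ ∀ q ∈ Ioo s t \ N, ∀ r ∈ Ioo s t \ N, q < r →
      1 / 2 * ‖v r‖ ^ 2 - 1 / 2 * ‖v q‖ ^ 2
        + ∫ τ in q..r, energyRate ν (f τ) (v τ) ≤ 0 := by
  set E : ℝ → ℝ := fun τ => relEnergy (v τ) 0 + ξ τ with hE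
  have hEq : ∀ q ∈ Ioo 0 T, ((Ioo 0 T).indicator E) =ᶠ[𝓝 q] E := fun q hq =>
    eqOn_indicator.eventuallyEq_of_mem (isOpen_Ioo.mem_nhds hq)
  have hgood := (ae_eq_of_tendsto_inf_ae hv.locallyIntegrable_energy).and
    ((ae_restrict_iff' measurableSet_Ioo).1 hξ)
  -- The exceptional set is the set where `hgood` fails, whence the double negations below.
  refine ⟨_, hgood, fun q hq r hr hqr => ?_⟩
  have hq' := not_not.1 hq.2
  have hr' := not_not.1 hr.2
  have hq0 : q ∈ Ioo 0 T := ⟨hs.trans hq.1.1, hq.1.2.trans ht⟩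
  have hr0 : r ∈ Ioo 0 T := ⟨hs.trans hr.1.1, hr.1.2.trans ht⟩
  have hzero := isC1Sol_zero (Ω := Ω)
  have hcurve : ∀ τ, hzero.curve τ = 0 := fun τ => Subtype.ext
    (Lp.ext ((hzero.curve_ae_eq τ).trans (Lp.coeFn_zero _ _ _).symm))
  have hrate : ∀ τ, weakRate ν (f τ) (v τ) (hzero.curve τ) (hzero.velocity τ) = 0 := by
    intro τ
    -- Homogeneity with factor `0` shows that the rate vanishes on the zero curve.
    have h1 := hzero.weakRate_const_smul hΩ ν (f τ) (v τ) 0 τ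
    simpa using h1
  obtain ⟨a, b, ha, hb, hab⟩ := hv.energy_le_of_isC1Sol hΩ hν hf hq0.1.le hqr.le hr0.2.le
    (ae_mono (Measure.restrict_mono (Ioo_subset_Ioo hq.1.1.le hr.1.2.le) le_rfl) hξ) hzero
    (hcurve q) (hcurve r)
  simp only [hrate, intervalIntegral.integral_zero, sub_zero] at hab
  rw [rightLim, if_pos hr0.2] at ha
  rw [leftLim, if_pos hq0.1] at hb
  have ha' : a = (Ioo 0 T).indicator E r := hr'.1.2 a (ha.congr'
    ((hEq r hr0).symm.filter_mono (inf_le_left.trans nhdsWithin_le_nhds)))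
  have hb' : b = (Ioo 0 T).indicator E q := hq'.1.1 b (hb.congr'
    ((hEq q hq0).symm.filter_mono (inf_le_left.trans nhdsWithin_le_nhds)))
  rw [indicator_of_mem hr0, hE] at ha'
  rw [indicator_of_mem hq0, hE] at hb'
  simp only [hr'.2 hr.1, hq'.2 hq.1, relEnergy, sub_zero, add_zero] at ha' hb'
  linarith

theorem IsSolution.integral_weakRate_eq_zero (hΩ : IsOpen Ω) {T ν : ℝ} (hν : 0 ≤ ν)
    {f : ℝ → Hm1 Ω × L2 Ω (Fin d)} (hf : MemZ Ω T ν f) {v₀ : L2sol Ω} {v : ℝ → L2sol Ω}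
    {ξ : ℝ → ℝ} (hv : IsSolution Ω T ν f v₀ v ξ) {s t : ℝ} (hs : 0 < s) (hst : s < t)
    (ht : t < T) (hξ : ∀ᵐ τ ∂(volume.restrict (Ioo s t)), ξ τ = 0) {φ : ℝ → Eu d → Eu d}
    (hφ : IsC1Sol Ω φ) (hφs : hφ.curve s = 0) (hφt : hφ.curve t = 0) :
    ∫ τ in s..t, weakRate ν (f τ) (v τ) (hφ.curve τ) (hφ.velocity τ) = 0 := by
  have := nhdsGT_inf_ae_neBot t
  have := nhdsLT_inf_ae_neBot s
  obtain ⟨a, b, ha, hb, -⟩ := hv.energy_le_of_isC1Sol hΩ hν hf hs.le hst.le ht.le hξ hφ hφs hφt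
  rw [rightLim, if_pos ht] at ha
  rw [leftLim, if_pos hs] at hb
  set I := ∫ τ in s..t, weakRate ν (f τ) (v τ) (hφ.curve τ) (hφ.velocity τ) with hI
  set C := ∫ τ in s..t, energyRate ν (f τ) (v τ) with hC
  -- The limits at `t+` and `s-` are taken outside `(s,t)`, where `ξ` may be nonzero. Only their
  -- independence of `c` matters.
  have key : ∀ c : ℝ, a + (C - c * I) ≤ b := by
    intro c
    obtain ⟨a', b', ha', hb', h⟩ := hv.energy_le_of_isC1Sol hΩ hν hf hs.le hst.le ht.le hξ
      (hφ.const_smul c) (by rw [hφ.curve_const_smul, hφs, smul_zero])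
      (by rw [hφ.curve_const_smul, hφt, smul_zero])
    rw [rightLim, if_pos ht] at ha'
    rw [leftLim, if_pos hs] at hb'
    simp only [hφ.weakRate_const_smul hΩ, intervalIntegral.integral_const_mul] at h
    rwa [tendsto_nhds_unique ha ha', tendsto_nhds_unique hb hb']
  by_contra hne
  -- For this `c` the inequality reads `b + 1 ≤ b`.
  have := key ((a + C - b - 1) / I)
  rw [div_mul_cancel₀ _ hne] at this
  linarith

end Solutions

end EnergyVariational

end

open MeasureTheory Set EnergyVariational in
theorem proposition2 {d : ℕ} (hd : 2 ≤ d) (Ω : Set (Eu d)) (hΩ_open : IsOpen Ω)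
    (hΩ_conn : IsConnected Ω) (hΩ_bdd : Bornology.IsBounded Ω)
    (T ν : ℝ) (hT : 0 < T) (hν : 0 ≤ ν)
    (f : ℝ → Hm1 Ω × L2 Ω (Fin d)) (hf : MemZ Ω T ν f) (v₀ : L2sol Ω)
    (v : ℝ → L2sol Ω) (ξ : ℝ → ℝ) (hv : IsSolution Ω T ν f v₀ v ξ)
    (s t : ℝ) (hs : 0 < s) (hst : s < t) (ht : t < T)
    (hξ : ∀ᵐ τ ∂(volume.restrict (Ioo s t)), ξ τ = 0) :
    (∃ N : Set ℝ, volume N = 0 ∧ ∀ q ∈ Ioo s t \ N, ∀ r ∈ Ioo s t \ N, q < r →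
      1 / 2 * ‖v r‖ ^ 2 - 1 / 2 * ‖v q‖ ^ 2
        + ∫ τ in q..r, (ν * ‖weakGrad Ω (v τ : L2 Ω (Fin d))‖ ^ 2
            - forcePair (f τ) (v τ : L2 Ω (Fin d))) ≤ 0) ∧
    ∀ φ : ℝ → Eu d → Eu d, IsC1cSol Ω s t φ →
      ∫ τ in s..t,
        (ν * (∫ x in Ω, inner ℝ (weakGrad Ω (v τ : L2 Ω (Fin d)) x) (grad (φ τ) x))
          - (∫ x in Ω, ∑ i, ∑ j,
              (v τ : L2 Ω (Fin d)) x i * (v τ : L2 Ω (Fin d)) x j * grad (φ τ) x (i, j))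
          - (∫ x in Ω, inner ℝ ((v τ : L2 Ω (Fin d)) x) (timeDeriv φ τ x))
          - forcePair (f τ) (toL2 Ω (φ τ))) = 0 := by
  have hfin : IsFiniteMeasure (volume.restrict Ω) :=
    ⟨by simpa using hΩ_bdd.measure_lt_top⟩
  refine ⟨hv.exists_null_energy_le hΩ_open hν hf hs ht hξ, ?_⟩
  rintro φ ⟨hφ, J, -, hJ, hφJ⟩
  -- The interval is open, so the test field vanishes at both end points `s` and `t`.
  have hcurve : ∀ τ, τ ∉ Ioo s t → hφ.curve τ = 0 := by
    intro τ hτ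
    have h0 : φ τ = 0 := funext fun x => hφJ τ (fun h => hτ (hJ h)) x
    refine Subtype.ext (Lp.ext ((hφ.curve_ae_eq τ).trans ?_))
    rw [h0]
    exact (Lp.coeFn_zero _ _ _).symm
  have := hv.integral_weakRate_eq_zero hΩ_open hν hf hs hst ht hξ hφ (hcurve s (by simp))
    (hcurve t (by simp))
  simpa only [hφ.weakRate_eq hΩ_open] using this
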